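/- Theorem 1 (thm:dDistHS). A multilinear depth-$3$ circuit over a field $\mathbb F$ with $n$ variables and top fan-in $k$ is an expression $C(x)=\sum_{i=1}^k a_i\prod_{j=1}^{n_i}\ell_{ij}$, where $a_i\in\mathbb F$, every $\ell_{ij}=b_0+\sum_{r=1}^n b_rx_r$ is an affine linear polynomial over $\mathbb F$, and the polynomial computed at each gate is multilinear. Its $i$-th product gate induces a partition of $\{x_1,\dots,x_n\}$ whose parts (colors) consist of the variables of the single factors $\ell_{ij}$ (variables absent from the gate, which occur with coefficient $0$, may be placed arbitrarily). The circuit has $\delta$-distance if its product gates can be ordered so that the induced partitions $\mathcal P_1,\dots,\mathcal P_k$ satisfy: for every $i\in\{2,\dots,k\}$ and every color $Y_1\in\mathcal P_i$ there are colors $Y_2,\dots,Y_{\delta'}\in\mathcal P_i$ with $\delta'\le\delta$ such that, for each $j<i$, the set $Y_1\cup\dots\cup Y_{\delta'}$ is a union of colors of $\mathcal P_j$. For all $n,k,\delta\ge 1$ there is a hitting-set for the class of $n$-variate multilinear depth-$3$ circuits with top fan-in $k$ and $\delta$-distance that is computable in time $n^{O(\delta\log k)}$ (where, so that $n=1$ and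 $k=1$ are included, this is read as $(n+1)^{O(\delta\log_2(k+1))}$). More precisely, there are a constant $c$ and one program for a random access machine, both independent of $n,k,\delta$ and of the field, such that the following holds for $T=(n+1)^{c\,\delta\lfloor\log_2(k+1)\rfloor}$. Let $K$ be a field and let $\alpha_0,\alpha_1,\dots$ be a sequence in $K$, accessible to the program, whose first $T$ elements are distinct (so $|K|\ge T$). On input $(n,k,\delta)$ the program outputs, within $T$ steps (unit cost for ring operations in $K$, for fetching an $\alpha_i$, for copying, for addition and truncated subtraction of natural numbers, and for tests of natural numbers for zero), a list of points $H\subseteq K^n$ such that for every subfield $\mathbb F$ of $K$ and every $n$-variate multilinear depth-$3$ circuit $C$ over $\mathbb F$ with top fan-in $k$ and $\delta$-distance that computes a nonzero polynomial, there is $h\in H$ with $C(h)\ne 0$. (One may take $K=\mathbb F$ if $\mathbb F$ has at least $T$ elements, and an extension of $\mathbb F$ otherwise.) -/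

import Mathlib

universe u v

/-! ### Multilinear depth-3 circuits -/

/-- An affine-linear polynomial `b₀ + ∑ r, b r * x r` in `n` variables. -/
structure AffineForm (F : Type u) (n : ℕ) where
  const : F
  coeff : Fin n → F

namespace AffineForm

/-- The variables present in the affine form. -/
def vars {F : Type u} [Zero F] {n : ℕ} (l : AffineForm F n) : Set (Fin n) :=
  {r | l.coeff r ≠ 0}

noncomputable def toPoly {F : Type u} [CommSemiring F] {n : ℕ} (l : AffineForm F n) :
    MvPolynomial (Fin n) F :=
  MvPolynomial.C l.const + ∑ r, MvPolynomial.C (l.coeff r) * MvPolynomial.X r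

end AffineForm

/-- A depth-3 (`ΣΠΣ`) circuit `∑ i, a i * ∏ j, l i j` in `n` variables with top fan-in `k`.
The fan-ins of the product gates are arbitrary. -/
structure DepthThreeCircuit (F : Type u) (n k : ℕ) where
  weight : Fin k → F
  factors : Fin k → List (AffineForm F n)

/-- Every variable has degree at most one in every monomial. -/
def IsMultilinearPoly {F : Type u} [CommSemiring F] {n : ℕ} (f : MvPolynomial (Fin n) F) : Prop :=
  ∀ m ∈ f.support, ∀ r, m r ≤ 1

namespace DepthThreeCircuit

noncomputable def gatePoly {F : Type u} [CommSemiring F] {n k : ℕ} (C : DepthThreeCircuit F n k)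
    (i : Fin k) : MvPolynomial (Fin n) F :=
  ((C.factors i).map AffineForm.toPoly).prod

/-- The polynomial computed by the circuit. -/
noncomputable def toPoly {F : Type u} [CommSemiring F] {n k : ℕ} (C : DepthThreeCircuit F n k) :
    MvPolynomial (Fin n) F :=
  ∑ i, MvPolynomial.C (C.weight i) * C.gatePoly i

/-- The polynomial computed at every gate is multilinear (this is automatic at the bottom gates,
which compute affine forms). -/
def IsMultilinear {F : Type u} [CommSemiring F] {n k : ℕ} (C : DepthThreeCircuit F n k) : Prop :=
  (∀ i, IsMultilinearPoly (C.gatePoly i)) ∧ IsMultilinearPoly C.toPoly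

end DepthThreeCircuit

/-- The product gate with the given factors induces the partition `P` of the variables: the
variables of each factor lie in one color, and no color meets two of the factors.
If all variables occur in the gate, then `P` consists of the variable sets of the nonconstant
factors; a variable that does not occur in the gate may be put anywhere (it occurs with
coefficient zero). -/
def InducesPartition {F : Type u} [Zero F] {n : ℕ} (L : List (AffineForm F n))
    (P : Finpartition (Finset.univ : Finset (Fin n))) : Prop :=
  (∀ l ∈ L, l.vars.Nonempty → ∃ Y ∈ P.parts, l.vars ⊆ (Y : Set (Fin n))) ∧
  L.Pairwise fun l l' => ∀ Y ∈ P.parts,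
    ¬ ((l.vars ∩ (Y : Set (Fin n))).Nonempty ∧ (l'.vars ∩ (Y : Set (Fin n))).Nonempty)

/-- The partition sequence has distance at most `δ`: in every partition except the first, every
color `Y₁` belongs to a set `N` of at most `δ` colors whose union is, for each earlier partition,
a union of colors of that partition. -/
def PartitionDistanceLE {n k : ℕ}
    (P : Fin k → Finpartition (Finset.univ : Finset (Fin n))) (δ : ℕ) : Prop :=
  ∀ i : Fin k, 0 < i.val → ∀ Y₁ ∈ (P i).parts,
    ∃ N ⊆ (P i).parts, Y₁ ∈ N ∧ N.card ≤ δ ∧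
      ∀ j < i, ∃ Z ⊆ (P j).parts, Z.sup id = N.sup id

/-- The circuit has `δ`-distance: its product gates can be ordered to correspond to a partition
sequence of distance at most `δ`. -/
def DepthThreeCircuit.HasDistance {F : Type u} [Zero F] {n k : ℕ} (C : DepthThreeCircuit F n k)
    (δ : ℕ) : Prop :=
  ∃ (σ : Equiv.Perm (Fin k)) (P : Fin k → Finpartition (Finset.univ : Finset (Fin n))),
    (∀ i, InducesPartition (C.factors (σ i)) (P i)) ∧ PartitionDistanceLE P δ

/-- A set `H` of points with coordinates in `K` is a hitting-set for the `n`-variate multilinear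
depth-3 circuits over `F` with top fan-in `k` and `δ`-distance: every such circuit that computes
a nonzero polynomial is nonzero at some point of `H`. -/
def IsHittingSet (F : Type u) [Field F] {K : Type v} [Field K] [Algebra F K] {n : ℕ} (k δ : ℕ)
    (H : Set (Fin n → K)) : Prop :=
  ∀ C : DepthThreeCircuit F n k, C.IsMultilinear → C.HasDistance δ → C.toPoly ≠ 0 →
    ∃ x ∈ H, MvPolynomial.aeval x C.toPoly ≠ 0

/-! ### Random access machines with field registers -/

/-- Programs of a random access machine with a memory of natural numbers, a memory of field
elements, and a write-only output tape of field elements. Programs mention no field. -/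
inductive RamProg : Type
  /-- `N[r] := c` -/
  | const (r c : ℕ)
  /-- `N[r] := N[s] + N[t]` -/
  | add (r s t : ℕ)
  /-- `N[r] := N[s] - N[t]`, truncated at zero -/
  | sub (r s t : ℕ)
  /-- `N[r] := N[N[s]]` -/
  | load (r s : ℕ)
  /-- `N[N[r]] := N[s]` -/
  | store (r s : ℕ)
  /-- `A[r] := 0` -/
  | fzero (r : ℕ)
  /-- `A[r] := 1` -/
  | fone (r : ℕ)
  /-- `A[r] := α N[s]`, where `α` is the given enumeration of field elements -/
  | felem (r s : ℕ)
  /-- `A[r] := A[s] + A[t]` -/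
  | fadd (r s t : ℕ)
  /-- `A[r] := A[s] - A[t]` -/
  | fsub (r s t : ℕ)
  /-- `A[r] := A[s] * A[t]` -/
  | fmul (r s t : ℕ)
  /-- `A[r] := A[N[s]]` -/
  | fload (r s : ℕ)
  /-- `A[N[r]] := A[s]` -/
  | fstore (r s : ℕ)
  /-- append `A[r]` to the output -/
  | emit (r : ℕ)
  /-- first `p`, then `q` -/
  | seq (p q : RamProg)
  /-- if `N[r] = 0` then `p`, else `q` -/
  | ifZero (r : ℕ) (p q : RamProg)
  /-- while `N[r] ≠ 0` do `p` -/
  | whileNonzero (r : ℕ) (p : RamProg)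

structure RamState (K : Type v) where
  N : ℕ → ℕ
  A : ℕ → K
  out : List K

/-- The state in which a computation on the input `(n, k, δ)` starts. -/
def RamState.initial (K : Type v) [Zero K] (n k δ : ℕ) : RamState K where
  N := fun i => if i = 0 then n else if i = 1 then k else if i = 2 then δ else 0
  A := fun _ => 0
  out := []

/-- `RamExec α p s t s'`: the program `p`, started in the state `s`, halts in the state `s'` after
exactly `t` steps. Every instruction and every test of a register takes one step. There is no
multiplication of natural numbers. -/
inductive RamExec {K : Type v} [Field K] (α : ℕ → K) :
    RamProg → RamState K → ℕ → RamState K → Prop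
  | const (r c : ℕ) (s : RamState K) :
      RamExec α (.const r c) s 1 { s with N := Function.update s.N r c }
  | add (r a b : ℕ) (s : RamState K) :
      RamExec α (.add r a b) s 1 { s with N := Function.update s.N r (s.N a + s.N b) }
  | sub (r a b : ℕ) (s : RamState K) :
      RamExec α (.sub r a b) s 1 { s with N := Function.update s.N r (s.N a - s.N b) }
  | load (r a : ℕ) (s : RamState K) :
      RamExec α (.load r a) s 1 { s with N := Function.update s.N r (s.N (s.N a)) }
  | store (r a : ℕ) (s : RamState K) :
      RamExec α (.store r a) s 1 { s with N := Function.update s.N (s.N r) (s.N a) }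
  | fzero (r : ℕ) (s : RamState K) :
      RamExec α (.fzero r) s 1 { s with A := Function.update s.A r 0 }
  | fone (r : ℕ) (s : RamState K) :
      RamExec α (.fone r) s 1 { s with A := Function.update s.A r 1 }
  | felem (r a : ℕ) (s : RamState K) :
      RamExec α (.felem r a) s 1 { s with A := Function.update s.A r (α (s.N a)) }
  | fadd (r a b : ℕ) (s : RamState K) :
      RamExec α (.fadd r a b) s 1 { s with A := Function.update s.A r (s.A a + s.A b) }
  | fsub (r a b : ℕ) (s : RamState K) :
      RamExec α (.fsub r a b) s 1 { s with A := Function.update s.A r (s.A a - s.A b) }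
  | fmul (r a b : ℕ) (s : RamState K) :
      RamExec α (.fmul r a b) s 1 { s with A := Function.update s.A r (s.A a * s.A b) }
  | fload (r a : ℕ) (s : RamState K) :
      RamExec α (.fload r a) s 1 { s with A := Function.update s.A r (s.A (s.N a)) }
  | fstore (r a : ℕ) (s : RamState K) :
      RamExec α (.fstore r a) s 1 { s with A := Function.update s.A (s.N r) (s.A a) }
  | emit (r : ℕ) (s : RamState K) :
      RamExec α (.emit r) s 1 { s with out := s.out ++ [s.A r] }
  | seq {p q : RamProg} {s s' s'' : RamState K} {t t' : ℕ} :
      RamExec α p s t s' → RamExec α q s' t' s'' → RamExec α (.seq p q) s (t + t') s''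
  | ifZero_zero {r : ℕ} {p q : RamProg} {s s' : RamState K} {t : ℕ} :
      s.N r = 0 → RamExec α p s t s' → RamExec α (.ifZero r p q) s (t + 1) s'
  | ifZero_pos {r : ℕ} {p q : RamProg} {s s' : RamState K} {t : ℕ} :
      s.N r ≠ 0 → RamExec α q s t s' → RamExec α (.ifZero r p q) s (t + 1) s'
  | whileNonzero_zero {r : ℕ} {p : RamProg} {s : RamState K} :
      s.N r = 0 → RamExec α (.whileNonzero r p) s 1 s
  | whileNonzero_pos {r : ℕ} {p : RamProg} {s s' s'' : RamState K} {t t' : ℕ} :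
      s.N r ≠ 0 → RamExec α p s t s' → RamExec α (.whileNonzero r p) s' t' s'' →
      RamExec α (.whileNonzero r p) s (t + t' + 1) s''

/-- On the input `(n, k, δ)` and with the enumeration `α`, the program halts within `T` steps,
and its output is the list of the coordinates of the points in `H`, point after point. -/
def OutputsPointsWithin {K : Type v} [Field K] (α : ℕ → K) (p : RamProg) (n k δ T : ℕ)
    (H : List (Fin n → K)) : Prop :=
  ∃ (t : ℕ) (s : RamState K), t ≤ T ∧ RamExec α p (RamState.initial K n k δ) t s ∧
    s.out = (H.map List.ofFn).flatten

/-!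
Order the gates so that their partitions have `δ`-distance. The joins of the first `i` partitions
form an increasing chain, and gate `i` is a product along the `i`-th join: each of its classes is
covered by at most `δ` colors, so every factor has degree at most `δ`.

Substitute `x r + X ^ w r` for `x r`, where the weights `w` isolate the monomials of small degree.
For fewer than `2 ^ m` gates that are products along the same partition, a nonzero sum has, after
this shift, a monomial that meets fewer than `m` classes: fix `m` classes and look at the
coefficients of the monomials in their variables. They lie in the span of fewer than `2 ^ m`
polynomials, while those whose degree plus weight is maximal have distinct degrees and, if no
monomial with fewer classes survives, number at least `2 ^ m`. For a chain of `2 ^ h` partitions,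
split the chain in the middle. If a derivative of order `δ + 1` in a class of the middle partition
is nonzero, then it kills the upper half of the gates, and only the lower half of the chain
remains. Otherwise the gates may be truncated to degree `δ` in each class of the middle partition,
which moves the lower half of the gates to the middle and leaves only the upper half of the chain.
Either way the degree grows by at most `δ + 1`, and so a nonzero circuit has a shifted monomial of
degree `O(δ log k)`.

The monomials of degree at most `D` are isolated by `w r = 2 ^ r mod p` for some
`p ≤ (n + 1) ^ (2 * D + 2)`: otherwise each `p` divides the difference of two of the integers
`∑ r ∈ U, 2 ^ r`, and the product of these differences would be divisible by a central binomial
coefficient that exceeds it. For such weights the circuit is nonzero at a point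
`(a ^ w r + b * c ^ w r)_r`, since `b` separates the shifted monomials by degree and `c` those of
equal degree by weight. It remains to enumerate `p`, `a`, `b` and `c`.
-/

section CoefficientFunctions

open Finset

variable {σ R : Type*}

section Sums

variable [DecidableEq σ]

theorem sum_powerset_union_of_disjoint {M : Type*} [AddCommMonoid M] {B D : Finset σ}
    (h : Disjoint B D) (g : Finset σ → M) :
    ∑ V ∈ (B ∪ D).powerset, g V = ∑ V ∈ B.powerset, ∑ W ∈ D.powerset, g (V ∪ W) := by
  rw [← sum_product']
  refine (sum_nbij' (fun p => p.1 ∪ p.2) (fun V => (V ∩ B, V ∩ D)) ?_ ?_ ?_ ?_ ?_).symm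
  · simp only [mem_product, mem_powerset]
    exact fun p hp => union_subset_union hp.1 hp.2
  · simp
  · rintro ⟨V, W⟩ hp
    simp only [mem_product, mem_powerset] at hp
    simp only [union_inter_distrib_right, inter_eq_left.2 hp.1, inter_eq_left.2 hp.2,
      disjoint_iff_inter_eq_empty.1 (h.mono_left hp.1),
      disjoint_iff_inter_eq_empty.1 (h.symm.mono_left hp.2), union_empty, empty_union]
  · simp only [mem_powerset]
    exact fun V hV => by rw [← inter_union_distrib_left, inter_eq_left.2 hV]
  · simp

theorem sum_sum_powerset_sdiff [Fintype σ] {M : Type*} [AddCommMonoid M]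
    (g : Finset σ → Finset σ → M) :
    ∑ W, ∑ U ∈ W.powerset, g U (W \ U) = ∑ U, ∑ V ∈ Uᶜ.powerset, g U V := by
  rw [sum_sigma', sum_sigma']
  refine sum_nbij' (fun p => ⟨p.2, p.1 \ p.2⟩) (fun p => ⟨p.1 ∪ p.2, p.1⟩) ?_ ?_ ?_ ?_ ?_
  · simp [subset_compl_iff_disjoint_left, disjoint_sdiff]
  · simp only [mem_sigma, mem_univ, mem_powerset, true_and]
    exact fun p _ => subset_union_left
  · simp only [mem_sigma, mem_univ, mem_powerset, true_and]
    exact fun p hp => by rw [union_sdiff_of_subset hp]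
  · simp only [mem_sigma, mem_univ, mem_powerset, true_and]
    exact fun p hp => by
      rw [union_sdiff_cancel_left (subset_compl_iff_disjoint_left.1 hp)]
  · simp

end Sums

variable [CommSemiring R]

section MultilinearPoly

variable [Fintype σ]

/-- The multilinear polynomial with the coefficient `f U` at the monomial `∏ r ∈ U, X r`. -/
noncomputable def multilinearPoly : (Finset σ → R) →ₗ[R] MvPolynomial σ R :=
  Fintype.linearCombination R fun U => ∏ r ∈ U, MvPolynomial.X r

theorem aeval_multilinearPoly {A : Type*} [CommSemiring A] [Algebra R A] (x : σ → A)
    (f : Finset σ → R) :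
    MvPolynomial.aeval x (multilinearPoly f) = ∑ U, algebraMap R A (f U) * ∏ r ∈ U, x r := by
  simp [multilinearPoly, Fintype.linearCombination_apply, Algebra.smul_def]

theorem multilinearPoly_single [DecidableEq σ] (U : Finset σ) (c : R) :
    multilinearPoly (Pi.single U c) = c • ∏ r ∈ U, MvPolynomial.X r :=
  Fintype.linearCombination_apply_single ..

end MultilinearPoly

variable [DecidableEq σ]

/-- The coefficient function of the product of two multilinear polynomials in disjoint sets of
variables. -/
def subsetConv (f g : Finset σ → R) (W : Finset σ) : R :=
  ∑ U ∈ W.powerset, f U * g (W \ U)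

theorem exists_of_subsetConv_ne_zero {f g : Finset σ → R} {W : Finset σ}
    (h : subsetConv f g W ≠ 0) : ∃ U ⊆ W, f U ≠ 0 ∧ g (W \ U) ≠ 0 := by
  obtain ⟨U, hU, hne⟩ := exists_ne_zero_of_sum_ne_zero h
  exact ⟨U, mem_powerset.1 hU, left_ne_zero_of_mul hne, right_ne_zero_of_mul hne⟩

theorem multilinearPoly_subsetConv [Fintype σ] {f g : Finset σ → R}
    (h : ∀ U V, ¬ Disjoint U V → f U * g V = 0) :
    multilinearPoly (subsetConv f g) = multilinearPoly f * multilinearPoly g := by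
  let m (U V : Finset σ) : MvPolynomial σ R :=
    (f U * g V) • ((∏ r ∈ U, MvPolynomial.X r) * ∏ r ∈ V, MvPolynomial.X r)
  have hconv (W : Finset σ) :
      subsetConv f g W • ∏ r ∈ W, MvPolynomial.X r = ∑ U ∈ W.powerset, m U (W \ U) := by
    simp only [subsetConv, sum_smul, m]
    refine sum_congr rfl fun U hU => ?_
    rw [mul_comm (∏ r ∈ U, _), prod_sdiff (mem_powerset.1 hU)]
  calc multilinearPoly (subsetConv f g) = ∑ W, ∑ U ∈ W.powerset, m U (W \ U) :=
        sum_congr rfl fun W _ => hconv W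
    _ = ∑ U, ∑ V ∈ Uᶜ.powerset, m U V := sum_sum_powerset_sdiff m
    _ = ∑ U, ∑ V, m U V := by
        refine sum_congr rfl fun U _ => sum_subset (subset_univ _) fun V _ hV => ?_
        rw [mem_powerset, subset_compl_iff_disjoint_left] at hV
        simp only [m, h U V hV, zero_smul]
    _ = multilinearPoly f * multilinearPoly g := by
        simp only [multilinearPoly, Fintype.linearCombination_apply, sum_mul_sum, m,
          smul_mul_smul_comm]

/-- The coefficient function `f` is the product of a coefficient function in the variables of `A`
and one in the remaining variables. -/
def SplitsAt (A : Finset σ) (f : Finset σ → R) : Prop :=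
  ∃ P Q : Finset σ → R, ∀ U, f U = P (U ∩ A) * Q (U \ A)

namespace SplitsAt

variable {A : Finset σ} {f g : Finset σ → R}

theorem of_support_subset (h : ∀ U, f U ≠ 0 → U ⊆ A) : SplitsAt A f := by
  refine ⟨f, Pi.single ∅ 1, fun U => ?_⟩
  by_cases hU : U ⊆ A
  · simp [inter_eq_left.2 hU, sdiff_eq_empty_iff_subset.2 hU]
  · simp [not_imp_comm.1 (h U) hU, hU]

theorem of_support_disjoint (h : ∀ U, f U ≠ 0 → Disjoint U A) : SplitsAt A f := by
  refine ⟨Pi.single ∅ 1, f, fun U => ?_⟩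
  by_cases hU : Disjoint U A
  · simp [disjoint_iff_inter_eq_empty.1 hU, sdiff_eq_self_of_disjoint hU]
  · simp [not_imp_comm.1 (h U) hU, disjoint_iff_inter_eq_empty.not.1 hU]

theorem subsetConv (hf : SplitsAt A f) (hg : SplitsAt A g) :
    SplitsAt A (subsetConv f g) := by
  obtain ⟨P, Q, hf⟩ := hf
  obtain ⟨P', Q', hg⟩ := hg
  refine ⟨_root_.subsetConv P P', _root_.subsetConv Q Q', fun W => ?_⟩
  have hdisj : Disjoint (W ∩ A) (W \ A) := disjoint_sdiff.mono_left inter_subset_right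
  have hW : W ∩ A ∪ W \ A = W := sup_inf_sdiff W A
  rw [_root_.subsetConv, ← congrArg powerset hW, sum_powerset_union_of_disjoint hdisj,
    _root_.subsetConv, _root_.subsetConv, sum_mul_sum]
  refine sum_congr rfl fun U hU => sum_congr rfl fun V hV => ?_
  simp only [mem_powerset, subset_inter_iff, subset_sdiff] at hU hV
  have hUA : (U ∪ V) ∩ A = U := by
    rw [union_inter_distrib_right, inter_eq_left.2 hU.2, disjoint_iff_inter_eq_empty.1 hV.2,
      union_empty]
  have hVA : (U ∪ V) \ A = V := by
    rw [union_sdiff_distrib, sdiff_eq_empty_iff_subset.2 hU.2, sdiff_eq_self_of_disjoint hV.2,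
      empty_union]
  have hUW : (W \ (U ∪ V)) ∩ A = (W ∩ A) \ U := by grind
  have hVW : (W \ (U ∪ V)) \ A = (W \ A) \ V := by grind
  rw [hf, hg, hUA, hVA, hUW, hVW, mul_mul_mul_comm]

theorem smul (hf : SplitsAt A f) (c : R) : SplitsAt A (c • f) := by
  obtain ⟨P, Q, hf⟩ := hf
  exact ⟨c • P, Q, fun U => by simp only [Pi.smul_apply, hf, smul_mul_assoc]⟩

theorem ite {p : Finset σ → Prop} [DecidablePred p] (hf : SplitsAt A f)
    (hp : ∀ U, p U ↔ p (U ∩ A) ∧ p (U \ A)) : SplitsAt A fun U => if p U then f U else 0 := by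
  obtain ⟨P, Q, hf⟩ := hf
  refine ⟨fun U => if p U then P U else 0, fun U => if p U then Q U else 0, fun U => ?_⟩
  simp only [hp U, hf U, ite_and, ite_mul, mul_ite, zero_mul, mul_zero]
  split_ifs <;> rfl

end SplitsAt

end CoefficientFunctions

section FactorsAlong

open Finset

variable {σ R : Type*}

open Classical in
/-- The monomial `∏ r ∈ U, X r` has degree at most `δ` in each class of the equivalence relation
`s` on the variables. -/
def BlockDegreeLE (s : Setoid σ) (δ : ℕ) (U : Finset σ) : Prop :=
  ∀ r, #{x ∈ U | s x r} ≤ δ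

theorem BlockDegreeLE.mono {s : Setoid σ} {δ : ℕ} {U V : Finset σ} (h : BlockDegreeLE s δ V)
    (hUV : U ⊆ V) : BlockDegreeLE s δ U := by
  classical exact fun r => (card_le_card (filter_subset_filter _ hUV)).trans (h r)

theorem BlockDegreeLE.card_le_of_forall_rel {s : Setoid σ} {δ : ℕ} {U V : Finset σ}
    (h : BlockDegreeLE s δ U) (hVU : V ⊆ U) {x : σ} (hV : ∀ r ∈ V, s r x) : #V ≤ δ := by
  classical
  exact (card_le_card fun r hr => mem_filter.2 ⟨hVU hr, hV r hr⟩).trans (h x)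

variable [DecidableEq σ]

theorem blockDegreeLE_iff_inter_sdiff {s : Setoid σ} {A : Finset σ}
    (hA : s ≤ Setoid.ker (· ∈ A)) {δ : ℕ} {U : Finset σ} :
    BlockDegreeLE s δ U ↔ BlockDegreeLE s δ (U ∩ A) ∧ BlockDegreeLE s δ (U \ A) := by
  classical
  refine ⟨fun h => ⟨h.mono inter_subset_left, h.mono sdiff_subset⟩, fun h r => ?_⟩
  have hmem {x : σ} (hx : s x r) : x ∈ A ↔ r ∈ A := (Setoid.ker_def.1 (hA hx)).to_iff
  by_cases hr : r ∈ A
  · refine (card_le_card fun x hx => ?_).trans (h.1 r)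
    simp_all only [mem_filter, mem_inter, and_self]
  · refine (card_le_card fun x hx => ?_).trans (h.2 r)
    simp_all only [mem_filter, mem_sdiff, not_false_eq_true, and_self]

variable [CommSemiring R]

/-- The coefficient function of the iterated partial derivative with respect to the variables
in `D`. -/
def partialCoeff (D : Finset σ) (f : Finset σ → R) (U : Finset σ) : R :=
  if Disjoint U D then f (U ∪ D) else 0

theorem SplitsAt.partialCoeff {A : Finset σ} {f : Finset σ → R} (hf : SplitsAt A f)
    (D : Finset σ) : SplitsAt A (partialCoeff D f) := by
  obtain ⟨P, Q, hf⟩ := hf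
  refine ⟨_root_.partialCoeff (D ∩ A) P, _root_.partialCoeff (D \ A) Q, fun U => ?_⟩
  have hdisj : Disjoint U D ↔ Disjoint (U ∩ A) (D ∩ A) ∧ Disjoint (U \ A) (D \ A) := by
    simp only [disjoint_left, mem_inter, mem_sdiff, ← forall_and]
    exact forall_congr' fun r => by tauto
  simp only [_root_.partialCoeff, hdisj, hf, union_inter_distrib_right, union_sdiff_distrib,
    ite_and, ite_mul, mul_ite, zero_mul, mul_zero]
  split_ifs <;> rfl

/-- `f` is the coefficient function of a multilinear polynomial that is a product of polynomials
in the variables of the single classes of `s`, each of degree at most `δ`. The product structure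
is expressed through the splittings at all unions of classes. -/
structure FactorsAlong (s : Setoid σ) (δ : ℕ) (f : Finset σ → R) : Prop where
  splitsAt : ∀ A : Finset σ, s ≤ Setoid.ker (· ∈ A) → SplitsAt A f
  blockDegreeLE : ∀ U, f U ≠ 0 → BlockDegreeLE s δ U

open Classical in
/-- The part of a multilinear polynomial that has degree at most `δ` in each class of `s`. -/
noncomputable def truncateCoeff (s : Setoid σ) (δ : ℕ) (f : Finset σ → R) (U : Finset σ) : R :=
  if BlockDegreeLE s δ U then f U else 0

namespace FactorsAlong

variable {s : Setoid σ} {δ : ℕ} {f : Finset σ → R}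

theorem zero : FactorsAlong s δ (0 : Finset σ → R) :=
  ⟨fun _ _ => ⟨0, 0, by simp⟩, by simp⟩

theorem smul (h : FactorsAlong s δ f) (c : R) : FactorsAlong s δ (c • f) :=
  ⟨fun A hA => (h.splitsAt A hA).smul c,
    fun U hU => h.blockDegreeLE U (right_ne_zero_of_mul hU)⟩

theorem partialCoeff (h : FactorsAlong s δ f) (D : Finset σ) :
    FactorsAlong s δ (partialCoeff D f) := by
  refine ⟨fun A hA => (h.splitsAt A hA).partialCoeff D, fun U hU => ?_⟩
  exact (h.blockDegreeLE _ (ite_ne_right_iff.1 hU).2).mono subset_union_left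

theorem partialCoeff_eq_zero (h : FactorsAlong s δ f) {D : Finset σ} (hD : δ < #D) {x : σ}
    (hx : ∀ r ∈ D, s r x) : _root_.partialCoeff D f = 0 := by
  funext U
  by_contra hU
  have := h.blockDegreeLE _ (ite_ne_right_iff.1 hU).2
  exact hD.not_ge (this.card_le_of_forall_rel subset_union_right hx)

theorem truncateCoeff (h : FactorsAlong s δ f) {s' : Setoid σ} (hs : s ≤ s' ∨ s' ≤ s) :
    FactorsAlong (s ⊔ s') δ (truncateCoeff s' δ f) := by
  classical
  refine ⟨fun A hA => (h.splitsAt A (le_sup_left.trans hA)).ite fun U =>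
    blockDegreeLE_iff_inter_sdiff (le_sup_right.trans hA), fun U hU => ?_⟩
  obtain ⟨hU', hfU⟩ := ite_ne_right_iff.1 hU
  rcases hs with hs | hs
  · rwa [sup_eq_right.2 hs]
  · rw [sup_eq_left.2 hs]
    exact h.blockDegreeLE U hfU

end FactorsAlong

end FactorsAlong

section Shift

open Finset Polynomial

variable {σ R : Type*} [DecidableEq σ] [CommSemiring R]

/-- The coefficient at `∏ r ∈ S, x r` of the polynomial obtained from the multilinear polynomial
with coefficient function `f` by substituting `x r + X ^ w r` for `x r`, for all `r ∈ B`. -/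
noncomputable def shiftCoeff (w : σ → ℕ) (B : Finset σ) (f : Finset σ → R[X]) (S : Finset σ) :
    R[X] :=
  ∑ V ∈ (B \ S).powerset, f (S ∪ V) * X ^ (∑ r ∈ V, w r)

variable (w : σ → ℕ) {f : Finset σ → R[X]}

theorem exists_of_shiftCoeff_ne_zero {B S : Finset σ} (h : shiftCoeff w B f S ≠ 0) :
    ∃ U, S ⊆ U ∧ f U ≠ 0 := by
  obtain ⟨V, -, hV⟩ := exists_ne_zero_of_sum_ne_zero h
  exact ⟨S ∪ V, subset_union_left, left_ne_zero_of_mul hV⟩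

theorem shiftCoeff_sum {ι : Type*} [Fintype ι] (g : ι → Finset σ → R[X]) (B S : Finset σ) :
    shiftCoeff w B (fun U => ∑ i, g i U) S = ∑ i, shiftCoeff w B (g i) S := by
  simp only [shiftCoeff, sum_mul]
  exact sum_comm

theorem map_shiftCoeff {A : Type*} [CommSemiring A] (φ : R →+* A) (B S : Finset σ) :
    (shiftCoeff w B f S).map φ = shiftCoeff w B (fun U => (f U).map φ) S := by
  simp only [shiftCoeff, Polynomial.map_sum, Polynomial.map_mul, Polynomial.map_pow, map_X]

theorem shiftCoeff_shiftCoeff {B D : Finset σ} (h : Disjoint B D) (S : Finset σ) :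
    shiftCoeff w B (shiftCoeff w D f) S = shiftCoeff w (B ∪ D) f S := by
  unfold shiftCoeff
  rw [union_sdiff_distrib, sum_powerset_union_of_disjoint (h.mono sdiff_subset sdiff_subset)]
  refine sum_congr rfl fun V hV => ?_
  rw [mem_powerset, subset_sdiff] at hV
  have hDV : D \ (S ∪ V) = D \ S := by
    rw [sdiff_union_distrib, sdiff_eq_self_of_disjoint (h.mono_left hV.1).symm]
    exact inter_eq_left.2 sdiff_subset
  rw [hDV, sum_mul]
  refine sum_congr rfl fun W hW => ?_
  have hVW : Disjoint V W := h.mono hV.1 ((mem_powerset.1 hW).trans sdiff_subset)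
  rw [sum_union hVW, pow_add, union_assoc, mul_assoc, mul_comm (X ^ _)]

/-- The shift in `B` is unitriangular for inclusion. -/
theorem eq_zero_of_shiftCoeff_eq_zero {B S : Finset σ}
    (h : ∀ β ⊆ B, shiftCoeff w B f (S ∪ β) = 0) : ∀ β ⊆ B, f (S ∪ β) = 0 := by
  intro β hβ
  induction hm : #(B \ β) using Nat.strong_induction_on generalizing β with
  | _ m ih =>
  subst hm
  have hsum := h β hβ
  rw [shiftCoeff, sum_eq_single ∅ (fun V hV hne => ?_) (by simp)] at hsum
  · simpa using hsum
  have hVB : V ⊆ B \ β :=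
    (mem_powerset.1 hV).trans (sdiff_subset_sdiff le_rfl subset_union_right)
  have hcard : #(B \ (β ∪ V)) < #(B \ β) := by
    rw [← sup_eq_union, ← sdiff_sdiff]
    exact card_lt_card (sdiff_ssubset hVB (nonempty_iff_ne_empty.2 hne))
  rw [union_assoc, ih _ hcard _ (union_subset hβ (hVB.trans sdiff_subset)) rfl, zero_mul]

theorem shiftCoeff_eq_zero_of_univ [Fintype σ] {B S : Finset σ}
    (h : ∀ β ⊆ Bᶜ, shiftCoeff w univ f (S ∪ β) = 0) :
    ∀ β ⊆ Bᶜ, shiftCoeff w B f (S ∪ β) = 0 := by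
  refine eq_zero_of_shiftCoeff_eq_zero w fun β hβ => ?_
  rw [shiftCoeff_shiftCoeff w disjoint_compl_left, union_comm, union_compl]
  exact h β hβ

theorem shiftCoeff_partialCoeff [Fintype σ] (D : Finset σ) :
    shiftCoeff w univ (partialCoeff D f) = partialCoeff D (shiftCoeff w univ f) := by
  funext S
  rw [partialCoeff]
  split_ifs with hS
  · unfold shiftCoeff partialCoeff
    refine (sum_subset_zero_on_sdiff (powerset_mono.2 <|
      sdiff_subset_sdiff le_rfl subset_union_left) (fun V hV => ?_) fun V hV => ?_).symm
    · simp only [mem_sdiff, mem_powerset, subset_sdiff, disjoint_union_right] at hV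
      rw [if_neg (fun hd => ?_), zero_mul]
      exact hV.2 ⟨subset_univ V, hV.1.2, (disjoint_union_left.1 hd).2⟩
    · rw [mem_powerset, subset_sdiff, disjoint_union_right] at hV
      rw [if_pos (disjoint_union_left.2 ⟨hS, hV.2.2⟩), union_right_comm]
  · refine sum_eq_zero fun V _ => ?_
    rw [partialCoeff, if_neg fun hd => hS (disjoint_union_left.1 hd).1, zero_mul]

theorem shiftCoeff_of_eq_mul {A B S α : Finset σ} {P Q : Finset σ → R[X]}
    (hf : ∀ U, f U = P (U ∩ A) * Q (U \ A)) (hB : Disjoint B A) (hS : Disjoint S A) (hα : α ⊆ A) :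
    shiftCoeff w B f (S ∪ α) = P α * shiftCoeff w B Q S := by
  have hset : B \ (S ∪ α) = B \ S := by
    rw [sdiff_union_distrib, sdiff_eq_self_of_disjoint (hB.mono_right hα)]
    exact inter_eq_left.2 sdiff_subset
  rw [shiftCoeff, shiftCoeff, hset, mul_sum]
  refine sum_congr rfl fun V hV => ?_
  have hV : Disjoint V A := hB.mono_left ((mem_powerset.1 hV).trans sdiff_subset)
  have hinter : (S ∪ α ∪ V) ∩ A = α := by
    rw [union_inter_distrib_right, union_inter_distrib_right, inter_eq_left.2 hα,
      disjoint_iff_inter_eq_empty.1 hS, disjoint_iff_inter_eq_empty.1 hV, union_empty, empty_union]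
  have hsdiff : (S ∪ α ∪ V) \ A = S ∪ V := by
    rw [union_sdiff_distrib, union_sdiff_distrib, sdiff_eq_empty_iff_subset.2 hα,
      sdiff_eq_self_of_disjoint hS, sdiff_eq_self_of_disjoint hV, union_empty]
  rw [hf, hinter, hsdiff, mul_assoc]

end Shift

section Isolation

open Finset Polynomial

variable {σ R : Type*}

/-- The weights `w` isolate the multilinear monomials of degree at most `D`: under the
substitution `x r = X ^ w r` they become distinct powers of `X`. -/
def Isolates (w : σ → ℕ) (D : ℕ) : Prop :=
  Set.InjOn (fun U : Finset σ => ∑ r ∈ U, w r) {U | #U ≤ D}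

theorem Isolates.mono {w : σ → ℕ} {D D' : ℕ} (h : Isolates w D') (hD : D ≤ D') : Isolates w D :=
  Set.InjOn.mono (fun _ hU => le_trans hU hD) h

theorem linearIndependent_of_natDegree_injective [CommRing R] [IsDomain R] {τ : Type*}
    {b : τ → R[X]} (hb : ∀ α, b α ≠ 0) (hinj : Function.Injective fun α => (b α).natDegree) :
    LinearIndependent R b := by
  refine linearIndependent_iff'.2 fun s d hsum α hα => ?_
  by_contra hdα
  have hsmul {β : τ} (hd : d β ≠ 0) : (d β • b β).degree = (b β).natDegree := by
    rw [smul_eq_C_mul, degree_C_mul hd, degree_eq_natDegree (hb β)]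
  have hdeg := degree_sum_eq_of_disjoint (fun β => d β • b β) s fun β hβ γ hγ hne h => hne <|
    hinj (by simpa [hsmul (left_ne_zero_of_smul hβ.2), hsmul (left_ne_zero_of_smul hγ.2)] using h)
  have hle : (d α • b α).degree ≤ s.sup fun β => (d β • b β).degree :=
    le_sup (f := fun β => (d β • b β).degree) hα
  rw [← hdeg, hsum, degree_zero, hsmul hdα, le_bot_iff] at hle
  exact WithBot.natCast_ne_bot _ hle

theorem card_le_card_of_natDegree_injOn [CommRing R] [IsDomain R] {τ ι : Type*} [Fintype ι]
    {b : τ → R[X]} {E : Finset τ} (hb : ∀ α ∈ E, b α ≠ 0)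
    (hinj : Set.InjOn (fun α => (b α).natDegree) E) {c : ι → R[X]}
    (hspan : ∀ α ∈ E, b α ∈ Submodule.span R (Set.range c)) : #E ≤ Fintype.card ι := by
  classical
  have hind : LinearIndependent R fun α : E => b α :=
    linearIndependent_of_natDegree_injective (fun α => hb α α.2) hinj.injective
  have hcard := linearIndependent_le_span_aux' _ hind (Set.range c)
    (Set.range_subset_iff.2 fun α => hspan α α.2)
  rw [Fintype.card_coe] at hcard
  exact hcard.trans (Fintype.card_range_le c)

variable [DecidableEq σ]

theorem two_pow_card_le_of_lines {κ : Type*} {A : κ → Finset σ} {J : Finset κ}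
    (hA : (J : Set κ).PairwiseDisjoint A) {E : Finset (Finset σ)} (hE : E.Nonempty)
    (hline : ∀ j ∈ J, ∀ α ∈ E, ∃ β ∈ E, β ≠ α ∧ β \ A j = α \ A j) : 2 ^ #J ≤ #E := by
  classical
  induction J using Finset.induction_on generalizing E with
  | empty => simpa using hE.card_pos
  | insert i J hi ih =>
  rw [coe_insert, Set.pairwiseDisjoint_insert_of_notMem hi] at hA
  obtain ⟨α, hα⟩ := hE
  obtain ⟨β, hβ, hne, hβα⟩ := hline i (mem_insert_self i J) α hα
  have hinter : β ∩ A i ≠ α ∩ A i := fun h => hne <| by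
    rw [← sdiff_union_inter β (A i), h, hβα, sdiff_union_inter]
  have hfiber {γ : Finset σ} (hγ : γ ∈ E) : 2 ^ #J ≤ #{x ∈ E | x ∩ A i = γ ∩ A i} := by
    refine ih hA.1 ⟨γ, by simp [hγ]⟩ fun j hj x hx => ?_
    rw [mem_filter] at hx
    obtain ⟨y, hy, hyx, hsdiff⟩ := hline j (mem_insert_of_mem hj) x hx.1
    have hsub : A i \ A j = A i := sdiff_eq_self_of_disjoint (hA.2 j hj)
    refine ⟨y, mem_filter.2 ⟨hy, ?_⟩, hyx, hsdiff⟩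
    rw [← hx.2, ← hsub, inter_sdiff_left_comm, hsdiff, inter_sdiff_left_comm]
  have hdisj : Disjoint {x ∈ E | x ∩ A i = α ∩ A i} {x ∈ E | x ∩ A i = β ∩ A i} :=
    disjoint_filter.2 fun x _ hxα hxβ => hinter (hxβ.symm.trans hxα)
  calc 2 ^ #(insert i J) = 2 ^ #J + 2 ^ #J := by rw [card_insert_of_notMem hi, pow_succ, mul_two]
    _ ≤ _ := Nat.add_le_add (hfiber hα) (hfiber hβ)
    _ = _ := (card_union_of_disjoint hdisj).symm
    _ ≤ #E := card_le_card (union_subset (filter_subset _ _) (filter_subset _ _))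

theorem exists_ne_of_shiftCoeff_eq_zero [CommSemiring R] {w : σ → ℕ} {b : Finset σ → R[X]}
    {A α : Finset σ} (hα : b α ≠ 0) (h : shiftCoeff w A b (α \ A) = 0) :
    ∃ β, β ≠ α ∧ β \ A = α \ A ∧ b β ≠ 0 ∧
      (b α).natDegree + ∑ r ∈ α, w r ≤ (b β).natDegree + ∑ r ∈ β, w r := by
  have hweight {V : Finset σ} (hV : V ⊆ A) :
      ∑ r ∈ α \ A ∪ V, w r = ∑ r ∈ α \ A, w r + ∑ r ∈ V, w r :=
    sum_union (disjoint_sdiff.symm.mono_right hV)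
  have hA : A \ (α \ A) = A := sdiff_eq_self_of_disjoint disjoint_sdiff
  have hmem : α ∩ A ∈ (A \ (α \ A)).powerset := by simp [hA]
  let N := (b α).natDegree + ∑ r ∈ α ∩ A, w r
  have hN := congrArg (coeff · N) h
  rw [shiftCoeff, ← add_sum_erase _ _ hmem, sdiff_union_inter] at hN
  have hlead : (b α * X ^ (∑ r ∈ α ∩ A, w r)).coeff N ≠ 0 := by
    rwa [coeff_mul_X_pow, coeff_natDegree, leadingCoeff_ne_zero]
  simp only [coeff_add, finsetSum_coeff, coeff_zero] at hN
  obtain ⟨V, hV, hne⟩ : ∃ V ∈ A.powerset.erase (α ∩ A),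
      (b (α \ A ∪ V) * X ^ (∑ r ∈ V, w r)).coeff N ≠ 0 := by
    by_contra! h0
    rw [hA, sum_eq_zero h0, add_zero] at hN
    exact hlead hN
  rw [mem_erase, mem_powerset] at hV
  have hle : N ≤ (b (α \ A ∪ V)).natDegree + ∑ r ∈ V, w r :=
    (le_natDegree_of_ne_zero hne).trans natDegree_mul_le |>.trans
      (Nat.add_le_add_left (natDegree_X_pow_le _) _)
  refine ⟨α \ A ∪ V, fun h => hV.1 ?_, ?_, fun h => hne (by rw [h, zero_mul, coeff_zero]), ?_⟩
  · rw [← h, union_inter_distrib_right, sdiff_inter_self, empty_union, inter_eq_left.2 hV.2]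
  · rw [union_sdiff_distrib, Finset.sdiff_idem, sdiff_eq_empty_iff_subset.2 hV.2, union_empty]
  · have hα' := hweight (V := α ∩ A) inter_subset_right
    rw [sdiff_union_inter] at hα'
    have := hweight hV.2
    omega

/-- Among the nonzero `b U`, those that maximize `natDegree + weight` have distinct degrees, hence
are linearly independent, and each direction `A j` leads from any of them to another one. -/
theorem eq_zero_of_mem_span_of_shiftCoeff_eq_zero [Finite σ] [CommRing R] [IsDomain R]
    {ι κ : Type*} [Fintype ι] {w : σ → ℕ} {A : κ → Finset σ} {J : Finset κ}
    (hA : (J : Set κ).PairwiseDisjoint A) (hι : Fintype.card ι < 2 ^ #J) {c : ι → R[X]}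
    {b : Finset σ → R[X]} (hspan : ∀ U, b U ∈ Submodule.span R (Set.range c))
    (hinj : Set.InjOn (fun U => ∑ r ∈ U, w r) (Function.support b))
    (hline : ∀ j ∈ J, ∀ U, Disjoint U (A j) → shiftCoeff w (A j) b U = 0) : b = 0 := by
  classical
  cases nonempty_fintype σ
  by_contra! hb
  let deg (U : Finset σ) : ℕ := (b U).natDegree + ∑ r ∈ U, w r
  obtain ⟨α₀, hα₀, hmax⟩ := exists_max_image {U | b U ≠ 0} deg
    ((Function.ne_iff.1 hb).imp fun U hU => mem_filter.2 ⟨mem_univ U, hU⟩)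
  let E : Finset (Finset σ) := {U | b U ≠ 0 ∧ deg U = deg α₀}
  have hE {U : Finset σ} : U ∈ E ↔ b U ≠ 0 ∧ deg U = deg α₀ := by simp [E]
  have hEne : E.Nonempty := ⟨α₀, hE.2 ⟨(mem_filter.1 hα₀).2, rfl⟩⟩
  have hEcard : #E ≤ Fintype.card ι := by
    refine card_le_card_of_natDegree_injOn (fun U hU => (hE.1 hU).1) (fun U hU V hV h => ?_)
      fun U _ => hspan U
    rw [mem_coe, hE] at hU hV
    have hdeg : deg U = deg V := hU.2.trans hV.2.symm
    exact hinj hU.1 hV.1 (Nat.add_left_cancel ((congrArg (· + _) h).symm.trans hdeg))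
  refine (two_pow_card_le_of_lines hA hEne fun j hj α hα => ?_).not_gt (hEcard.trans_lt hι)
  rw [hE] at hα
  obtain ⟨β, hne, hsdiff, hβ, hle⟩ :=
    exists_ne_of_shiftCoeff_eq_zero hα.1 (hline j hj _ disjoint_sdiff.symm)
  refine ⟨β, hE.2 ⟨hβ, (hmax β (mem_filter.2 ⟨mem_univ β, hβ⟩)).antisymm ?_⟩, hne, hsdiff⟩
  exact hα.2.symm.le.trans hle

end Isolation

section Concentration

open Finset Polynomial

variable {σ R ι : Type*} [Fintype ι]

section Splitting

variable [DecidableEq σ] [CommRing R] {G : ι → Finset σ → R}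

theorem exists_shiftCoeff_mem_span (w : σ → ℕ) {A B S : Finset σ}
    (hG : ∀ i, SplitsAt A (G i)) (hB : Disjoint B A) (hS : Disjoint S A) :
    ∃ c : ι → R[X], ∀ α ⊆ A,
      shiftCoeff w B (fun U => C (∑ i, G i U)) (S ∪ α) ∈ Submodule.span R (Set.range c) := by
  choose P Q hPQ using hG
  refine ⟨fun i => shiftCoeff w B (fun U => C (Q i U)) S, fun α hα => ?_⟩
  simp only [map_sum, shiftCoeff_sum]
  refine Submodule.sum_mem _ fun i _ => ?_
  rw [shiftCoeff_of_eq_mul w (P := fun U => C (P i U)) (Q := fun U => C (Q i U))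
    (fun U => by rw [hPQ, C_mul]) hB hS hα, ← smul_eq_C_mul]
  exact Submodule.smul_mem _ _ (Submodule.subset_span ⟨i, rfl⟩)

theorem FactorsAlong.blockDegreeLE_of_shiftCoeff_ne_zero {s : Setoid σ} {δ : ℕ} {w : σ → ℕ}
    (hG : ∀ i, FactorsAlong s δ (G i)) {B S : Finset σ}
    (h : shiftCoeff w B (fun U => C (∑ i, G i U)) S ≠ 0) :
    BlockDegreeLE s δ S := by
  obtain ⟨U, hSU, hU⟩ := exists_of_shiftCoeff_ne_zero w h
  obtain ⟨i, -, hi⟩ := exists_ne_zero_of_sum_ne_zero (C_ne_zero.1 hU)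
  exact ((hG i).blockDegreeLE U hi).mono hSU

theorem shiftCoeff_ite_subset [Fintype σ] (w : σ → ℕ) {F : Finset σ → R[X]} {A D S U : Finset σ}
    (hS : Disjoint S A) (hD : D ⊆ A) (hU : U ⊆ A) :
    shiftCoeff w D (fun U => if U ⊆ A then shiftCoeff w Aᶜ F (S ∪ U) else 0) U =
      shiftCoeff w (D ∪ Aᶜ) F (S ∪ U) := by
  have hset : D \ (S ∪ U) = D \ U := by
    rw [sdiff_union_distrib, sdiff_eq_self_of_disjoint (hS.mono_right hD).symm]
    exact inter_eq_right.2 sdiff_subset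
  rw [← shiftCoeff_shiftCoeff w (disjoint_compl_right.mono_left hD), shiftCoeff, shiftCoeff, hset]
  refine sum_congr rfl fun V hV => ?_
  rw [if_pos (union_subset hU (((mem_powerset.1 hV).trans sdiff_subset).trans hD)), union_assoc]

theorem shiftCoeff_ite_subset_eq_zero [Fintype σ] {w : σ → ℕ} {F : Finset σ → R[X]}
    {A D S : Finset σ} (hS : Disjoint S A) (hD : D ⊆ A)
    (h : ∀ β ⊆ A \ D, shiftCoeff w univ F (S ∪ β) = 0) {U : Finset σ} (hU : Disjoint U D) :
    shiftCoeff w D (fun U => if U ⊆ A then shiftCoeff w Aᶜ F (S ∪ U) else 0) U = 0 := by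
  by_cases hUA : U ⊆ A
  · have hcompl : (D ∪ Aᶜ)ᶜ = A \ D := by
      rw [compl_union, compl_compl, inter_comm, sdiff_eq_inter_compl]
    rw [shiftCoeff_ite_subset w hS hD hUA]
    exact shiftCoeff_eq_zero_of_univ w (hcompl ▸ h) U (hcompl ▸ subset_sdiff.2 ⟨hUA, hU⟩)
  · refine sum_eq_zero fun V _ => ?_
    exact mul_eq_zero_of_left (if_neg fun h => hUA (subset_union_left.trans h)) _

end Splitting

variable [Fintype σ]

open Classical in
/-- The set of all variables whose class lies in `J`. -/
noncomputable def classUnion {s : Setoid σ} (J : Finset (Quotient s)) : Finset σ :=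
  {r | ⟦r⟧ ∈ J}

theorem mem_classUnion {s : Setoid σ} {J : Finset (Quotient s)} {r : σ} :
    r ∈ classUnion J ↔ ⟦r⟧ ∈ J := by
  simp [classUnion]

theorem le_ker_mem_classUnion {s : Setoid σ} (J : Finset (Quotient s)) :
    s ≤ Setoid.ker (· ∈ classUnion J) := fun x y hxy =>
  Setoid.ker_def.2 <| by simp only [mem_classUnion, Quotient.sound hxy]

theorem BlockDegreeLE.card_le_mul_card {s : Setoid σ} {δ : ℕ} {U : Finset σ}
    (h : BlockDegreeLE s δ U) {J : Finset (Quotient s)} (hU : U ⊆ classUnion J) :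
    #U ≤ δ * #J := by
  classical
  refine card_le_mul_card_image_of_maps_to (fun r hr => mem_classUnion.1 (hU hr)) δ fun j _ => ?_
  induction j using Quotient.ind with
  | _ x =>
  exact (h.mono (filter_subset _ U)).card_le_of_forall_rel subset_rfl fun r hr =>
    Quotient.exact (mem_filter.1 hr).2

variable [DecidableEq σ] [CommRing R] [IsDomain R] {s : Setoid σ} {δ : ℕ} {w : σ → ℕ}
  {G : ι → Finset σ → R}

theorem shiftCoeff_eq_zero_of_sdiff_class (hG : ∀ i, FactorsAlong s δ (G i))
    {J : Finset (Quotient s)} (hw : Isolates w (δ * #J)) (hι : Fintype.card ι < 2 ^ #J)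
    {S : Finset σ} (hS : Disjoint S (classUnion J))
    (h : ∀ j ∈ J, ∀ β ⊆ classUnion J \ classUnion {j},
      shiftCoeff w univ (fun U => C (∑ i, G i U)) (S ∪ β) = 0) :
    ∀ β ⊆ classUnion J, shiftCoeff w univ (fun U => C (∑ i, G i U)) (S ∪ β) = 0 := by
  set A := classUnion J
  set F : Finset σ → R[X] := fun U => C (∑ i, G i U)
  obtain ⟨c, hc⟩ := exists_shiftCoeff_mem_span w
    (fun i => (hG i).splitsAt A (le_ker_mem_classUnion J)) disjoint_compl_left hS
  let b (U : Finset σ) : R[X] := if U ⊆ A then shiftCoeff w Aᶜ F (S ∪ U) else 0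
  have hb : b = 0 := by
    refine eq_zero_of_mem_span_of_shiftCoeff_eq_zero (A := fun j => classUnion {j}) (w := w)
      (J := J) (fun i _ j _ hij => ?_) hι (c := c) (fun U => ?_)
      (Set.InjOn.mono (fun U hU => ?_) hw) fun j hj U hU => ?_
    · rw [Function.onFun, disjoint_left]
      intro r hi hj
      rw [mem_classUnion, mem_singleton] at hi hj
      exact hij (hi.symm.trans hj)
    · by_cases hU : U ⊆ A
      · simpa only [b, if_pos hU] using hc U hU
      · simp only [b, if_neg hU, Submodule.zero_mem]
    · obtain ⟨hUA, hU⟩ := ite_ne_right_iff.1 hU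
      have hdeg := FactorsAlong.blockDegreeLE_of_shiftCoeff_ne_zero hG hU
      exact (hdeg.mono subset_union_right).card_le_mul_card hUA
    · refine shiftCoeff_ite_subset_eq_zero hS (fun r hr => mem_classUnion.2 ?_) (h j hj) hU
      rwa [mem_singleton.1 (mem_classUnion.1 hr)]
  intro β hβ
  rw [← union_compl A, ← shiftCoeff_ite_subset w hS subset_rfl hβ]
  exact sum_eq_zero fun V _ => mul_eq_zero_of_left (congrFun hb (β ∪ V)) _

theorem shiftCoeff_eq_zero_of_card_le {m : ℕ} (hG : ∀ i, FactorsAlong s δ (G i))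
    (hw : Isolates w (δ * m)) (hι : Fintype.card ι < 2 ^ m)
    (h : ∀ T, #T ≤ δ * m → shiftCoeff w univ (fun U => C (∑ i, G i U)) T = 0) (S : Finset σ) :
    shiftCoeff w univ (fun U => C (∑ i, G i U)) S = 0 := by
  classical
  let classes (S : Finset σ) : Finset (Quotient s) := S.image Quotient.mk''
  induction hN : #(classes S) using Nat.strong_induction_on generalizing S with
  | _ N ih =>
  subst hN
  rcases lt_or_ge #(classes S) m with hm | hm
  · by_contra hne
    refine hne (h S ?_)
    have hdeg := FactorsAlong.blockDegreeLE_of_shiftCoeff_ne_zero hG hne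
    refine (hdeg.card_le_mul_card (J := classes S) fun r hr => ?_).trans
      (Nat.mul_le_mul_left δ hm.le)
    exact mem_classUnion.2 (mem_image_of_mem _ hr)
  · obtain ⟨J, hJ, rfl⟩ := exists_subset_card_eq hm
    rw [← sdiff_union_inter S (classUnion J)]
    refine shiftCoeff_eq_zero_of_sdiff_class hG hw hι disjoint_sdiff.symm (fun j hj β hβ => ?_) _
      inter_subset_right
    refine ih _ (card_lt_card ((ssubset_iff_of_subset ?_).2 ⟨j, hJ hj, ?_⟩)) _ rfl
    · refine image_subset_iff.2 fun r hr => ?_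
      rcases mem_union.1 hr with hr | hr
      · exact mem_image_of_mem _ (mem_sdiff.1 hr).1
      · exact hJ (mem_classUnion.1 (mem_sdiff.1 (hβ hr)).1)
    · rw [mem_image]
      rintro ⟨r, hr, rfl⟩
      rcases mem_union.1 hr with hr | hr
      · exact (mem_sdiff.1 hr).2 (mem_classUnion.2 hj)
      · exact (mem_sdiff.1 (hβ hr)).2 (mem_classUnion.2 (mem_singleton_self _))

end Concentration

section Chain

open Finset Polynomial

variable {σ ι R : Type*} [DecidableEq σ] [Fintype ι]

theorem partialCoeff_C_sum [CommSemiring R] (D : Finset σ) (G : ι → Finset σ → R) :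
    partialCoeff D (fun U => C (∑ i, G i U)) = fun U => C (∑ i, partialCoeff D (G i) U) := by
  funext U
  simp only [partialCoeff]
  split_ifs <;> simp

theorem sum_truncateCoeff [CommSemiring R] {s : Setoid σ} {δ : ℕ} {G : ι → Finset σ → R}
    (h : ∀ D, #D = δ + 1 → ∀ x, (∀ r ∈ D, s r x) → ∀ U, ∑ i, partialCoeff D (G i) U = 0)
    (U : Finset σ) : ∑ i, truncateCoeff s δ (G i) U = ∑ i, G i U := by
  classical
  simp only [truncateCoeff]
  split_ifs with hU
  · rfl
  obtain ⟨x, hx⟩ := not_forall.1 hU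
  obtain ⟨D, hDx, hD⟩ := exists_subset_card_eq (Nat.succ_le_of_lt (not_le.1 hx))
  have hDU : D ⊆ U := hDx.trans (filter_subset _ U)
  have := h D hD x (fun r hr => (mem_filter.1 (hDx hr)).2) (U \ D)
  simpa only [sum_const_zero, partialCoeff, if_pos sdiff_disjoint, sdiff_union_of_subset hDU,
    eq_comm] using this

variable [Fintype σ] [CommRing R] [IsDomain R]

/-- Induction on the number of halvings of the chain. Derivatives of order `δ + 1` in a class of
the middle partition kill the gates above it, and once these derivatives of the sum vanish,
truncation moves the gates below it to the middle. -/
theorem sum_eq_zero_of_shiftCoeff_eq_zero {w : σ → ℕ} {δ m : ℕ} (hw : Isolates w (δ * m))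
    (hι : Fintype.card ι < 2 ^ m) {q : ℕ → Setoid σ} (hq : Monotone q) {a h : ℕ}
    {G : ι → Finset σ → R} (hG : ∀ i, ∃ l, a ≤ l ∧ l < a + 2 ^ h ∧ FactorsAlong (q l) δ (G i))
    (h0 : ∀ T, #T ≤ δ * m + (δ + 1) * h → shiftCoeff w univ (fun U => C (∑ i, G i U)) T = 0)
    (U : Finset σ) : ∑ i, G i U = 0 := by
  induction h generalizing a G U with
  | zero =>
    have hGa (i : ι) : FactorsAlong (q a) δ (G i) := by
      obtain ⟨l, hal, hla, hl⟩ := hG i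
      rwa [← show l = a by omega]
    have hshift := shiftCoeff_eq_zero_of_card_le hGa hw hι h0
    have := eq_zero_of_shiftCoeff_eq_zero w (S := ∅) (fun β _ => hshift _) U (subset_univ U)
    rwa [empty_union, C_eq_zero] at this
  | succ h ih =>
    have hpow : 0 < 2 ^ h := by positivity
    set b := a + 2 ^ h
    have hpartial (D : Finset σ) (hD : #D = δ + 1) (x : σ) (hx : ∀ r ∈ D, q b r x) :
        ∀ U, ∑ i, partialCoeff D (G i) U = 0 := by
      refine ih (a := a) (G := fun i => partialCoeff D (G i)) (fun i => ?_) fun T hT => ?_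
      · obtain ⟨l, hal, hla, hl⟩ := hG i
        rcases lt_or_ge l b with hlb | hbl
        · exact ⟨l, hal, hlb, hl.partialCoeff D⟩
        · refine ⟨a, le_rfl, by omega, ?_⟩
          rw [hl.partialCoeff_eq_zero (by omega) fun r hr => hq hbl (hx r hr)]
          exact FactorsAlong.zero
      · rw [← partialCoeff_C_sum, shiftCoeff_partialCoeff, partialCoeff]
        split_ifs
        · refine h0 _ ((card_union_le T D).trans ?_)
          rw [hD, mul_add]
          omega
        · rfl
    have htruncate := sum_truncateCoeff hpartial
    rw [← htruncate]
    refine ih (a := b) (fun i => ?_) (fun T hT => ?_) U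
    · obtain ⟨l, -, hla, hl⟩ := hG i
      rw [pow_succ] at hla
      refine ⟨l ⊔ b, le_sup_right, by omega, ?_⟩
      rw [hq.map_sup]
      exact hl.truncateCoeff ((le_total l b).imp (hq ·) (hq ·))
    · simp only [htruncate]
      exact h0 T (hT.trans (by rw [mul_add]; omega))

end Chain

section Modulus

open Finset

theorem card_filter_card_le {σ : Type*} [Fintype σ] (D : ℕ) :
    #{U : Finset σ | #U ≤ D} ≤ (Fintype.card σ + 1) ^ D := by
  classical
  let entries (f : Fin D → Option σ) : Finset σ := {r | ∃ i, f i = some r}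
  have hsub : ({U | #U ≤ D} : Finset (Finset σ)) ⊆ univ.image entries := by
    intro U hU
    rw [mem_filter, ← length_toList] at hU
    refine mem_image.2 ⟨fun i => U.toList[i.val]?, mem_univ _, ?_⟩
    ext r
    simp only [entries, mem_filter, mem_univ, true_and, ← mem_toList (s := U),
      List.mem_iff_getElem?, Fin.exists_iff, exists_prop]
    refine ⟨fun ⟨i, _, h⟩ => ⟨i, h⟩, fun ⟨i, h⟩ => ⟨i, ?_, h⟩⟩
    exact (List.getElem?_eq_some_iff.1 h).1.trans_le hU.2
  refine (card_le_card hsub).trans (card_image_le.trans_eq ?_)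
  simp

theorem two_pow_lt_centralBinom {x : ℕ} (hx : 4 ≤ x) : 2 ^ x < x.centralBinom := by
  refine lt_of_mul_lt_mul_left' (a := x) ((?_ : _ ≤ 4 ^ x).trans_lt
    (Nat.four_pow_lt_mul_centralBinom x hx))
  calc x * 2 ^ x ≤ 2 ^ x * 2 ^ x := Nat.mul_le_mul_right _ Nat.lt_two_pow_self.le
    _ = 4 ^ x := by rw [← mul_pow]; rfl

/-- The prime powers that divide `x.centralBinom` are at most `2 * x`. -/
theorem centralBinom_dvd_prod {ι : Type*} {s : Finset ι} {d : ι → ℕ} {x : ℕ} (hx : 0 < x)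
    (hd : ∀ i ∈ s, d i ≠ 0) (h : ∀ p, 0 < p → p ≤ 2 * x → ∃ i ∈ s, p ∣ d i) :
    x.centralBinom ∣ ∏ i ∈ s, d i := by
  have hprod : ∏ i ∈ s, d i ≠ 0 := prod_ne_zero_iff.2 hd
  rw [← Nat.factorization_prime_le_iff_dvd x.centralBinom_ne_zero hprod]
  intro p hp
  obtain ⟨i, hi, hdvd⟩ := h (p ^ x.centralBinom.factorization p) (pow_pos hp.pos _)
    (Nat.pow_factorization_choose_le (by omega))
  rw [← hp.pow_dvd_iff_le_factorization hprod]
  exact hdvd.trans (dvd_prod_of_mem d hi)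

theorem exists_forall_not_dvd {ι : Type*} {s : Finset ι} {d : ι → ℕ} {n x : ℕ}
    (hd : ∀ i ∈ s, d i ≠ 0 ∧ d i ≤ 2 ^ n) (hx : n * #s ≤ x) (hx4 : 4 ≤ x) :
    ∃ p, 0 < p ∧ p ≤ 2 * x ∧ ∀ i ∈ s, ¬p ∣ d i := by
  by_contra! h
  have hdvd := centralBinom_dvd_prod (by omega) (fun i hi => (hd i hi).1) h
  have hpos : 0 < ∏ i ∈ s, d i := prod_pos fun i hi => Nat.pos_of_ne_zero (hd i hi).1
  refine (Nat.le_of_dvd hpos hdvd).not_gt (lt_of_le_of_lt ?_ (two_pow_lt_centralBinom hx4))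
  calc ∏ i ∈ s, d i ≤ (2 ^ n) ^ #s := prod_le_pow_card s d _ fun i hi => (hd i hi).2
    _ = 2 ^ (n * #s) := (pow_mul _ _ _).symm
    _ ≤ 2 ^ x := Nat.pow_le_pow_right two_pos hx

theorem exists_injOn_mod {ι : Type*} {s : Finset ι} {e : ι → ℕ} {n x : ℕ} (he : Set.InjOn e s)
    (hlt : ∀ i ∈ s, e i < 2 ^ n) (hx : n * (#s * #s) ≤ x) (hx4 : 4 ≤ x) :
    ∃ p, 0 < p ∧ p ≤ 2 * x ∧ Set.InjOn (e · % p) s := by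
  classical
  have hd : ∀ z ∈ s.offDiag,
      ((e z.1 : ℤ) - e z.2).natAbs ≠ 0 ∧ ((e z.1 : ℤ) - e z.2).natAbs ≤ 2 ^ n := fun z hz => by
    obtain ⟨hz1, hz2, hne⟩ := mem_offDiag.1 hz
    have := he.ne hz1 hz2 hne
    have := hlt z.1 hz1
    have := hlt z.2 hz2
    omega
  have hcard : n * #s.offDiag ≤ x :=
    (Nat.mul_le_mul_left n (offDiag_card s ▸ Nat.sub_le _ _)).trans hx
  obtain ⟨p, hp0, hp, hpd⟩ := exists_forall_not_dvd hd hcard hx4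
  refine ⟨p, hp0, hp, fun i hi j hj hij => ?_⟩
  by_contra hne
  refine hpd (i, j) (mem_offDiag.2 ⟨hi, hj, hne⟩) (Int.natCast_dvd.1 ?_)
  exact Nat.modEq_iff_dvd.1 (show e j ≡ e i [MOD p] from hij.symm)

theorem exists_isolates_two_pow_mod {n D : ℕ} (hn : 1 ≤ n) (hD : 1 ≤ D) :
    ∃ p, 0 < p ∧ p ≤ (n + 1) ^ (2 * D + 2) ∧ Isolates (fun r : Fin n => 2 ^ r.val % p) D := by
  let e (U : Finset (Fin n)) : ℕ := ∑ r ∈ U, 2 ^ r.val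
  have he (U : Finset (Fin n)) : e U = ∑ i ∈ U.map Fin.valEmbedding, 2 ^ i := by simp [e]
  have hinj : Function.Injective e := fun U V h =>
    map_injective _ (geomSum_injective le_rfl (by simpa only [he] using h))
  have hlt (U : Finset (Fin n)) : e U < 2 ^ n := by
    refine he U ▸ Nat.geomSum_lt le_rfl fun i hi => ?_
    obtain ⟨r, -, rfl⟩ := mem_map.1 hi
    exact r.2
  let s : Finset (Finset (Fin n)) := {U | #U ≤ D}
  have hs : #s * #s ≤ (n + 1) ^ (2 * D) := by
    have hs : #s ≤ (n + 1) ^ D := by simpa using card_filter_card_le (σ := Fin n) D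
    calc #s * #s ≤ (n + 1) ^ D * (n + 1) ^ D := Nat.mul_le_mul hs hs
      _ = (n + 1) ^ (2 * D) := by ring
  obtain ⟨p, hp0, hp, hpinj⟩ := exists_injOn_mod (hinj.injOn (s := s)) (fun U _ => hlt U)
    ((Nat.mul_le_mul_left n hs).trans (Nat.le_add_right _ 4)) (Nat.le_add_left 4 _)
  refine ⟨p, hp0, hp.trans ?_, fun U hU V hV h => hpinj ?_ ?_ ?_⟩
  · have h4 : 4 ≤ (n + 1) ^ (2 * D) :=
      (Nat.pow_le_pow_left (show 2 ≤ n + 1 by omega) 2).trans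
        (Nat.pow_le_pow_right n.succ_pos (by omega))
    rw [pow_add]
    nlinarith [Nat.mul_le_mul hn hn]
  · simpa [s] using hU
  · simpa [s] using hV
  · calc e U % p = (∑ r ∈ U, 2 ^ r.val % p) % p := sum_nat_mod _ _ _
      _ = (∑ r ∈ V, 2 ^ r.val % p) % p := congrArg (· % p) h
      _ = e V % p := (sum_nat_mod _ _ _).symm

end Modulus

section Circuits

open Finset

namespace AffineForm

variable {F : Type*} [CommSemiring F] {n : ℕ}

/-- The coefficient function of an affine form. -/
def multilinearCoeff (l : AffineForm F n) : Finset (Fin n) → F :=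
  Pi.single ∅ l.const + ∑ r, Pi.single {r} (l.coeff r)

theorem eq_empty_or_singleton_of_multilinearCoeff_ne_zero {l : AffineForm F n}
    {U : Finset (Fin n)} (h : l.multilinearCoeff U ≠ 0) : U = ∅ ∨ ∃ r ∈ l.vars, U = {r} := by
  by_contra! hU
  refine h ?_
  rw [multilinearCoeff, Pi.add_apply, Pi.single_eq_of_ne hU.1.ne_empty, zero_add, Finset.sum_apply]
  refine sum_eq_zero fun r _ => ?_
  by_cases hr : r ∈ l.vars
  · exact Pi.single_eq_of_ne (hU.2 r hr) _
  · rw [not_not.1 hr, Pi.single_zero, Pi.zero_apply]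

theorem mem_vars_of_multilinearCoeff_ne_zero {l : AffineForm F n} {U : Finset (Fin n)}
    (h : l.multilinearCoeff U ≠ 0) {r : Fin n} (hr : r ∈ U) : r ∈ l.vars := by
  rcases eq_empty_or_singleton_of_multilinearCoeff_ne_zero h with rfl | ⟨x, hx, rfl⟩
  · simp at hr
  · rwa [mem_singleton.1 hr]

theorem multilinearPoly_multilinearCoeff (l : AffineForm F n) :
    multilinearPoly l.multilinearCoeff = l.toPoly := by
  simp only [multilinearCoeff, map_add, map_sum, multilinearPoly_single, prod_empty,
    prod_singleton, MvPolynomial.smul_eq_C_mul, mul_one, toPoly]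

end AffineForm

section ProductCoeff

variable {F : Type*} [CommSemiring F] {n : ℕ}

/-- The coefficient function of a product of affine forms in disjoint sets of variables. -/
def productCoeff : List (AffineForm F n) → Finset (Fin n) → F
  | [] => Pi.single ∅ 1
  | l :: L => subsetConv l.multilinearCoeff (productCoeff L)

theorem exists_mem_vars_of_productCoeff_ne_zero {L : List (AffineForm F n)} {U : Finset (Fin n)}
    (h : productCoeff L U ≠ 0) {r : Fin n} (hr : r ∈ U) : ∃ l ∈ L, r ∈ l.vars := by
  induction L generalizing U with
  | nil =>
    rw [productCoeff, Pi.single_apply, ite_ne_right_iff] at h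
    simp [h.1] at hr
  | cons l L ih =>
    obtain ⟨V, -, hV, hUV⟩ := exists_of_subsetConv_ne_zero h
    by_cases hrV : r ∈ V
    · exact ⟨l, List.mem_cons_self, l.mem_vars_of_multilinearCoeff_ne_zero hV hrV⟩
    · obtain ⟨l', hl', hr'⟩ := ih hUV (mem_sdiff.2 ⟨hr, hrV⟩)
      exact ⟨l', List.mem_cons_of_mem l hl', hr'⟩

theorem card_inter_le_one_of_productCoeff_ne_zero {L : List (AffineForm F n)}
    {Y : Finset (Fin n)} (hL : L.Pairwise fun l l' => ¬((l.vars ∩ (Y : Set (Fin n))).Nonempty ∧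
      (l'.vars ∩ (Y : Set (Fin n))).Nonempty))
    {U : Finset (Fin n)} (h : productCoeff L U ≠ 0) : #(U ∩ Y) ≤ 1 := by
  induction L generalizing U with
  | nil =>
    rw [productCoeff, Pi.single_apply, ite_ne_right_iff] at h
    simp [h.1]
  | cons l L ih =>
    rw [List.pairwise_cons] at hL
    obtain ⟨V, hVU, hV, hUV⟩ := exists_of_subsetConv_ne_zero h
    by_cases hVY : Disjoint V Y
    · have hUY : U ∩ Y = (U \ V) ∩ Y := by
        rw [sdiff_inter_right_comm,
          sdiff_eq_self_of_disjoint (hVY.symm.mono_left inter_subset_right)]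
      exact hUY ▸ ih hL.2 hUV
    · obtain ⟨x, hxV, hxY⟩ := not_disjoint_iff.1 hVY
      obtain rfl | ⟨y, hy, rfl⟩ := l.eq_empty_or_singleton_of_multilinearCoeff_ne_zero hV
      · simp at hxV
      obtain rfl := mem_singleton.1 hxV
      have hsub : U ∩ Y ⊆ {x} := by
        intro z hz
        by_contra hzx
        obtain ⟨l', hl', hz'⟩ :=
          exists_mem_vars_of_productCoeff_ne_zero hUV (mem_sdiff.2 ⟨(mem_inter.1 hz).1, hzx⟩)
        exact hL.1 l' hl' ⟨⟨x, hy, hxY⟩, ⟨z, hz', (mem_inter.1 hz).2⟩⟩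
      exact (card_le_card hsub).trans_eq (card_singleton x)

theorem splitsAt_productCoeff {L : List (AffineForm F n)} {A : Finset (Fin n)}
    (hL : ∀ l ∈ L, l.vars ⊆ A ∨ Disjoint l.vars A) : SplitsAt A (productCoeff L) := by
  induction L with
  | nil =>
    refine .of_support_subset fun U hU => ?_
    rw [productCoeff, Pi.single_apply, ite_ne_right_iff] at hU
    exact hU.1 ▸ empty_subset A
  | cons l L ih =>
    refine .subsetConv ?_ (ih fun l' hl' => hL l' (List.mem_cons_of_mem l hl'))
    rcases hL l List.mem_cons_self with hl | hl
    · exact .of_support_subset fun U hU r hr =>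
        hl (l.mem_vars_of_multilinearCoeff_ne_zero hU hr)
    · exact .of_support_disjoint fun U hU => disjoint_left.2 fun r hr hrA =>
        Set.disjoint_left.1 hl (l.mem_vars_of_multilinearCoeff_ne_zero hU hr) hrA

theorem multilinearPoly_productCoeff {L : List (AffineForm F n)}
    (hL : L.Pairwise fun l l' => Disjoint l.vars l'.vars) :
    multilinearPoly (productCoeff L) = (L.map AffineForm.toPoly).prod := by
  induction L with
  | nil => simp [productCoeff, multilinearPoly_single]
  | cons l L ih =>
    rw [List.pairwise_cons] at hL
    rw [List.map_cons, List.prod_cons, ← ih hL.2, ← l.multilinearPoly_multilinearCoeff]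
    refine multilinearPoly_subsetConv fun U V hUV => ?_
    by_contra h
    obtain ⟨r, hrU, hrV⟩ := not_disjoint_iff.1 hUV
    obtain ⟨l', hl', hr⟩ :=
      exists_mem_vars_of_productCoeff_ne_zero (right_ne_zero_of_mul h) hrV
    exact Set.disjoint_left.1 (hL.1 l' hl')
      (l.mem_vars_of_multilinearCoeff_ne_zero (left_ne_zero_of_mul h) hrU) hr

end ProductCoeff

theorem ker_part_le_ker_mem_sup {σ : Type*} [Fintype σ] [DecidableEq σ]
    {P : Finpartition (univ : Finset σ)} {Z : Finset (Finset σ)} (hZ : Z ⊆ P.parts) :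
    Setoid.ker P.part ≤ Setoid.ker (· ∈ Z.sup id) := by
  intro x y hxy
  have hxy : P.part x = P.part y := hxy
  refine propext ?_
  simp only [mem_sup, id]
  refine exists_congr fun Y => and_congr_right fun hY => ?_
  rw [← P.part_eq_iff_mem (hZ hY), hxy, P.part_eq_iff_mem (hZ hY)]

section JoinSetoid

variable {n k δ : ℕ} {P : Fin k → Finpartition (univ : Finset (Fin n))}

/-- The finest common coarsening of the partitions `P j`, `j ≤ i`, as an equivalence relation. -/
def joinSetoid (P : Fin k → Finpartition (univ : Finset (Fin n))) (i : ℕ) : Setoid (Fin n) :=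
  ⨆ j : Fin k, ⨆ _ : j.val ≤ i, Setoid.ker (P j).part

theorem joinSetoid_mono : Monotone (joinSetoid P) :=
  fun _ _ hij => iSup_mono fun _ => iSup_mono' fun hj => ⟨hj.trans hij, le_rfl⟩

theorem ker_part_le_joinSetoid (i : Fin k) : Setoid.ker (P i).part ≤ joinSetoid P i :=
  le_iSup₂_of_le i le_rfl le_rfl

theorem exists_joinSetoid_le_ker_mem_sup (hδ : 1 ≤ δ) (hP : PartitionDistanceLE P δ) (i : Fin k)
    (r : Fin n) : ∃ N ⊆ (P i).parts, #N ≤ δ ∧ r ∈ N.sup id ∧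
      joinSetoid P i ≤ Setoid.ker (· ∈ N.sup id) := by
  have hr : (P i).part r ∈ (P i).parts := (P i).part_mem.2 (mem_univ r)
  have hmem {N : Finset (Finset (Fin n))} (hN : (P i).part r ∈ N) : r ∈ N.sup id :=
    mem_sup.2 ⟨_, hN, (P i).mem_part (mem_univ r)⟩
  rcases Nat.eq_zero_or_pos i.val with h0 | h0
  · refine ⟨{(P i).part r}, singleton_subset_iff.2 hr, by simpa using hδ,
      hmem (mem_singleton_self _), iSup₂_le fun j hj => ?_⟩
    obtain rfl : j = i := by omega
    exact ker_part_le_ker_mem_sup (singleton_subset_iff.2 hr)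
  · obtain ⟨N, hN, hrN, hNδ, hsat⟩ := hP i h0 _ hr
    refine ⟨N, hN, hNδ, hmem hrN, iSup₂_le fun j hj => ?_⟩
    rcases Nat.lt_or_eq_of_le hj with hj | hj
    · obtain ⟨Z, hZ, hZN⟩ := hsat j hj
      exact hZN ▸ ker_part_le_ker_mem_sup hZ
    · obtain rfl := Fin.ext hj
      exact ker_part_le_ker_mem_sup hN

theorem InducesPartition.factorsAlong {F : Type*} [CommSemiring F] {L : List (AffineForm F n)}
    {i : Fin k} (hL : InducesPartition L (P i)) (hδ : 1 ≤ δ) (hP : PartitionDistanceLE P δ) :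
    FactorsAlong (joinSetoid P i) δ (productCoeff L) := by
  classical
  refine ⟨fun A hA => splitsAt_productCoeff fun l hl => ?_, fun U hU r => ?_⟩
  · refine or_iff_not_imp_right.2 fun hne => ?_
    obtain ⟨x, hx, hxA⟩ := Set.not_disjoint_iff.1 hne
    obtain ⟨Y, hY, hlY⟩ := hL.1 l hl ⟨x, hx⟩
    intro y hy
    have hxy : Setoid.ker (P i).part x y :=
      ((P i).part_eq_of_mem hY (hlY hx)).trans ((P i).part_eq_of_mem hY (hlY hy)).symm
    exact (hA (ker_part_le_joinSetoid i hxy)).mp hxA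
  · obtain ⟨N, hN, hNδ, hr, hsat⟩ := exists_joinSetoid_le_ker_mem_sup hδ hP i r
    have hsub : ({x ∈ U | joinSetoid P i x r} : Finset (Fin n)) ⊆ N.biUnion (U ∩ ·) := by
      intro x hx
      obtain ⟨hxU, hxr⟩ := mem_filter.1 hx
      obtain ⟨Y, hY, hxY⟩ := mem_sup.1 ((hsat hxr).mpr hr)
      exact mem_biUnion.2 ⟨Y, hY, mem_inter.2 ⟨hxU, hxY⟩⟩
    calc _ ≤ #(N.biUnion (U ∩ ·)) := card_le_card hsub
      _ ≤ #N * 1 := card_biUnion_le_card_mul _ _ _ fun Y hY =>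
        card_inter_le_one_of_productCoeff_ne_zero (hL.2.imp fun h => h Y (hN hY)) hU
      _ ≤ δ := by rwa [mul_one]

end JoinSetoid

theorem InducesPartition.pairwise_disjoint_vars {F : Type*} [Zero F] {n : ℕ}
    {L : List (AffineForm F n)} {P : Finpartition (univ : Finset (Fin n))}
    (hL : InducesPartition L P) : L.Pairwise fun l l' => Disjoint l.vars l'.vars := by
  refine hL.2.imp fun h => Set.disjoint_left.2 fun r hr hr' => ?_
  have hrP := P.mem_part (mem_univ r)
  exact h _ (P.part_mem.2 (mem_univ r)) ⟨⟨r, hr, hrP⟩, ⟨r, hr', hrP⟩⟩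

theorem DepthThreeCircuit.HasDistance.exists_factorsAlong {F : Type*} [CommSemiring F]
    {n k δ : ℕ} {C : DepthThreeCircuit F n k} (hC : C.HasDistance δ) (hδ : 1 ≤ δ) :
    ∃ (s : ℕ → Setoid (Fin n)) (f : Fin k → Finset (Fin n) → F), Monotone s ∧
      (∀ i : Fin k, FactorsAlong (s i) δ (f i)) ∧ multilinearPoly (∑ i, f i) = C.toPoly := by
  obtain ⟨σ, P, hind, hdist⟩ := hC
  refine ⟨joinSetoid P, fun i => C.weight (σ i) • productCoeff (C.factors (σ i)),
    joinSetoid_mono, fun i => ((hind i).factorsAlong hδ hdist).smul _, ?_⟩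
  rw [toPoly, map_sum, ← Equiv.sum_comp σ fun i => MvPolynomial.C _ * _]
  refine sum_congr rfl fun i _ => ?_
  rw [map_smul, multilinearPoly_productCoeff (hind i).pairwise_disjoint_vars,
    MvPolynomial.smul_eq_C_mul, gatePoly]

end Circuits

section Curve

open Finset Polynomial

/-- The point with the parameters `b`, `c` after the shift with the parameter `a`: the shift adds
`a ^ w r` to the coordinate `b * c ^ w r`, in which `b` records the degree of a monomial and `c`
its weight. -/
def curvePoint {σ R : Type*} [Semiring R] (w : σ → ℕ) (a b c : R) : σ → R :=
  fun r => a ^ w r + b * c ^ w r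

theorem sum_mul_prod_curvePoint {σ R : Type*} [Fintype σ] [DecidableEq σ] [CommSemiring R]
    (w : σ → ℕ) (f : Finset σ → R) (a b c : R) :
    ∑ U, f U * ∏ r ∈ U, curvePoint w a b c r =
      ∑ S, (shiftCoeff w univ (fun U => C (f U)) S).eval a * c ^ (∑ r ∈ S, w r) * b ^ #S := by
  let m (S V : Finset σ) : R :=
    f (S ∪ V) * a ^ (∑ r ∈ V, w r) * c ^ (∑ r ∈ S, w r) * b ^ #S
  have hprod (U : Finset σ) :
      f U * ∏ r ∈ U, curvePoint w a b c r = ∑ S ∈ U.powerset, m S (U \ S) := by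
    simp only [curvePoint, add_comm (a ^ _), prod_add, mul_sum, m]
    refine sum_congr rfl fun S hS => ?_
    rw [prod_mul_distrib, prod_const, prod_pow_eq_pow_sum, prod_pow_eq_pow_sum,
      union_sdiff_of_subset (mem_powerset.1 hS)]
    ring
  calc ∑ U, f U * ∏ r ∈ U, curvePoint w a b c r
      = ∑ U, ∑ S ∈ U.powerset, m S (U \ S) := sum_congr rfl fun U _ => hprod U
    _ = ∑ S, ∑ V ∈ Sᶜ.powerset, m S V := sum_sum_powerset_sdiff m
    _ = _ := sum_congr rfl fun S _ => by
      simp only [shiftCoeff, eval_finsetSum, eval_mul, eval_C, eval_pow, eval_X, sum_mul, m,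
        compl_eq_univ_sdiff]

variable {R : Type*} [CommRing R] [IsDomain R] {α : ℕ → R} {G : ℕ}

theorem exists_eval_ne_zero_of_natDegree_lt (hα : Set.InjOn α {i | i < G}) {p : R[X]} (hp : p ≠ 0)
    (hdeg : p.natDegree < G) : ∃ i < G, p.eval (α i) ≠ 0 := by
  by_contra! h
  refine hp (eq_zero_of_natDegree_lt_card_of_eval_eq_zero p (f := fun i : Fin G => α i)
    (fun i j hij => Fin.ext (hα i.2 j.2 hij)) (fun i => h i i.2) ?_)
  rwa [Fintype.card_fin]

theorem exists_sum_mul_pow_ne_zero (hα : Set.InjOn α {i | i < G}) {ι : Type*} {s : Finset ι}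
    {g : ι → R} {e : ι → ℕ} (he : ∀ i ∈ s, e i < G) {d : ℕ}
    (hd : ∑ i ∈ s with e i = d, g i ≠ 0) : ∃ j < G, ∑ i ∈ s, g i * α j ^ e i ≠ 0 := by
  have hcoeff : (∑ i ∈ s, C (g i) * X ^ e i).coeff d = ∑ i ∈ s with e i = d, g i := by
    simp only [finsetSum_coeff, coeff_C_mul_X_pow, sum_filter, eq_comm]
  obtain ⟨i, hi, -⟩ := exists_ne_zero_of_sum_ne_zero hd
  have hG : 0 < G := (he i (mem_filter.1 hi).1).bot_lt
  have hdeg : (∑ i ∈ s, C (g i) * X ^ e i).natDegree ≤ G - 1 :=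
    natDegree_sum_le_of_forall_le _ _ fun i hi =>
      (natDegree_C_mul_X_pow_le _ _).trans (Nat.le_sub_one_of_lt (he i hi))
  obtain ⟨j, hj, hne⟩ := exists_eval_ne_zero_of_natDegree_lt hα
    (fun h => hd (by rw [← hcoeff, h, coeff_zero])) (hdeg.trans_lt (Nat.sub_one_lt hG.ne'))
  exact ⟨j, hj, by simpa only [eval_finsetSum, eval_mul, eval_C, eval_pow, eval_X] using hne⟩

theorem exists_curvePoint_ne_zero {σ : Type*} [Fintype σ] [DecidableEq σ]
    (hα : Set.InjOn α {i | i < G}) {w : σ → ℕ} (hwG : ∑ r, w r < G) (hσG : Fintype.card σ < G)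
    {D : ℕ} (hw : Isolates w D) {f : Finset σ → R} {T : Finset σ} (hT : #T ≤ D)
    (hne : shiftCoeff w univ (fun U => C (f U)) T ≠ 0) :
    ∃ i < G, ∃ j < G, ∃ l < G,
      ∑ U, f U * ∏ r ∈ U, curvePoint w (α i) (α j) (α l) r ≠ 0 := by
  have hweight (S : Finset σ) : ∑ r ∈ S, w r < G :=
    (sum_le_univ_sum_of_nonneg fun r => (w r).zero_le).trans_lt hwG
  have hdeg : (shiftCoeff w univ (fun U => C (f U)) T).natDegree ≤ G - 1 :=
    natDegree_sum_le_of_forall_le _ _ fun V _ =>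
      (natDegree_C_mul_X_pow_le _ _).trans (Nat.le_sub_one_of_lt (hweight V))
  obtain ⟨i, hi, hTi⟩ := exists_eval_ne_zero_of_natDegree_lt hα hne
    (hdeg.trans_lt (Nat.sub_one_lt_of_lt hσG))
  let g (S : Finset σ) : R := (shiftCoeff w univ (fun U => C (f U)) S).eval (α i)
  have hfiber : ({S ∈ {S | #S = #T} | ∑ r ∈ S, w r = ∑ r ∈ T, w r} : Finset (Finset σ)) = {T} := by
    ext S
    simp only [mem_filter, mem_univ, true_and, mem_singleton]
    exact ⟨fun h => hw (h.1.trans_le hT) hT h.2, fun h => h ▸ ⟨rfl, rfl⟩⟩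
  obtain ⟨l, hl, hTl⟩ := exists_sum_mul_pow_ne_zero hα (s := {S | #S = #T}) (g := g)
    (fun S _ => hweight S) (d := ∑ r ∈ T, w r) (by rwa [hfiber, sum_singleton])
  obtain ⟨j, hj, hTj⟩ := exists_sum_mul_pow_ne_zero hα
    (fun S _ => (card_le_univ S).trans_lt hσG) hTl
  exact ⟨i, hi, j, hj, l, hl, by rwa [sum_mul_prod_curvePoint]⟩

end Curve

section HittingSet

open Finset

/-- The points of the curves for the weights `2 ^ r mod p`, `p ≤ M`, with parameters among the
first `G` elements of the given sequence. -/
def curveGrid {K : Type*} [Semiring K] (α : ℕ → K) (n M G : ℕ) : Set (Fin n → K) :=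
  {x | ∃ m < M, ∃ i < G, ∃ j < G, ∃ l < G,
    x = curvePoint (fun r : Fin n => 2 ^ r.val % (m + 1)) (α i) (α j) (α l)}

theorem DepthThreeCircuit.HasDistance.exists_shiftCoeff_ne_zero {F : Type*} [CommRing F]
    [IsDomain F] {n k δ h : ℕ} {C : DepthThreeCircuit F n k} (hC : C.HasDistance δ) (hδ : 1 ≤ δ)
    (hk : k < 2 ^ h) (h0 : C.toPoly ≠ 0) {w : Fin n → ℕ} (hw : Isolates w (δ * h)) :
    ∃ f : Finset (Fin n) → F, multilinearPoly f = C.toPoly ∧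
      ∃ T, #T ≤ δ * h + (δ + 1) * h ∧
        shiftCoeff w univ (fun U => Polynomial.C (f U)) T ≠ 0 := by
  obtain ⟨s, f, hs, hf, hpoly⟩ := hC.exists_factorsAlong hδ
  have hchain (i : Fin k) : ∃ l, 0 ≤ l ∧ l < 0 + 2 ^ h ∧ FactorsAlong (s l) δ (f i) :=
    ⟨i, Nat.zero_le _, by omega, hf i⟩
  refine ⟨fun U => ∑ i, f i U, by rw [← hpoly, sum_fn], ?_⟩
  by_contra! hshift
  refine h0 (hpoly ▸ (congrArg multilinearPoly (funext fun U => ?_)).trans (map_zero _))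
  rw [Finset.sum_apply]
  exact sum_eq_zero_of_shiftCoeff_eq_zero hw (by rwa [Fintype.card_fin]) hs hchain hshift U

theorem isHittingSet_curveGrid {F : Type u} [Field F] {K : Type v} [Field K] [Algebra F K]
    {n k δ h M G : ℕ} (hn : 1 ≤ n) (hδ : 1 ≤ δ) (hh : 1 ≤ h) (hk : k < 2 ^ h)
    (hM : (n + 1) ^ (8 * δ * h) ≤ M) (hG : n * M < G) {α : ℕ → K}
    (hα : Set.InjOn α {i | i < G}) : IsHittingSet F k δ (curveGrid α n M G) := by
  intro C _ hC h0
  have hδh : 1 ≤ δ * h := Nat.mul_pos hδ hh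
  have hhδ : h ≤ δ * h := Nat.le_mul_of_pos_left _ hδ
  obtain ⟨p, hp0, hp, hw⟩ :=
    exists_isolates_two_pow_mod (D := δ * h + (δ + 1) * h) hn (by omega)
  have hpM : p ≤ M := by
    refine hp.trans ((Nat.pow_le_pow_right n.succ_pos ?_).trans hM)
    rw [add_mul, mul_assoc]
    omega
  let w (r : Fin n) : ℕ := 2 ^ r.val % p
  have hwG : ∑ r, w r < G := by
    refine lt_of_le_of_lt ?_ hG
    simpa using sum_le_card_nsmul univ w M fun r _ => (Nat.mod_lt _ hp0).le.trans hpM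
  have hnG : Fintype.card (Fin n) < G := by
    simpa using (Nat.le_mul_of_pos_right n (hp0.trans_le hpM)).trans_lt hG
  obtain ⟨f, hf, T, hT, hne⟩ :=
    hC.exists_shiftCoeff_ne_zero hδ hk h0 (hw.mono (Nat.le_add_right _ _))
  have hne' : shiftCoeff w univ (fun U => Polynomial.C (algebraMap F K (f U))) T ≠ 0 := by
    simpa only [map_shiftCoeff, Polynomial.map_C] using
      Polynomial.map_ne_zero (f := algebraMap F K) hne
  obtain ⟨i, hi, j, hj, l, hl, hx⟩ := exists_curvePoint_ne_zero hα hwG hnG hw hT hne'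
  refine ⟨_, ⟨p - 1, by omega, i, hi, j, hj, l, hl, rfl⟩, ?_⟩
  rwa [← hf, aeval_multilinearPoly, Nat.sub_add_cancel hp0]

end HittingSet

section Memory

variable {K : Type v} {s : RamState K}

/-- The registers `N[i]`, `i < m`, and `A[i]`, `i < q`, have the same contents in both states. -/
structure RamState.Keeps (m q : ℕ) (s s' : RamState K) : Prop where
  nat : ∀ i < m, s'.N i = s.N i
  field : ∀ i < q, s'.A i = s.A i

namespace RamState.Keeps

variable {m q m' q' r : ℕ} {s' s'' : RamState K}

theorem refl (s : RamState K) : s.Keeps m q s :=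
  ⟨fun _ _ => rfl, fun _ _ => rfl⟩

theorem trans (h : s.Keeps m q s') (h' : s'.Keeps m q s'') : s.Keeps m q s'' :=
  ⟨fun i hi => (h'.nat i hi).trans (h.nat i hi), fun i hi => (h'.field i hi).trans (h.field i hi)⟩

theorem mono (h : s.Keeps m q s') (hm : m' ≤ m) (hq : q' ≤ q) : s.Keeps m' q' s' :=
  ⟨fun i hi => h.nat i (hi.trans_le hm), fun i hi => h.field i (hi.trans_le hq)⟩

theorem update_nat (h : s.Keeps m q s') (hr : m ≤ r) (x : ℕ) :
    s.Keeps m q { s' with N := Function.update s'.N r x } :=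
  ⟨fun i hi => (Function.update_of_ne (by omega) _ _).trans (h.nat i hi), h.field⟩

theorem update_field (h : s.Keeps m q s') (hr : q ≤ r) (x : K) :
    s.Keeps m q { s' with A := Function.update s'.A r x } :=
  ⟨h.nat, fun i hi => (Function.update_of_ne (by omega) _ _).trans (h.field i hi)⟩

end RamState.Keeps

end Memory

section Halting

variable {K : Type v} [Field K] {α : ℕ → K} {p p' : RamProg} {s : RamState K} {B B' : ℕ}
  {Q R : RamState K → Prop}

/-- The program `p`, started in the state `s`, halts within `B` steps in a state with the
property `Q`. -/
def Halts (α : ℕ → K) (p : RamProg) (s : RamState K) (B : ℕ) (Q : RamState K → Prop) : Prop :=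
  ∃ t s', t ≤ B ∧ RamExec α p s t s' ∧ Q s'

theorem Halts.mono (h : Halts α p s B Q) (hB : B ≤ B') (hQ : ∀ s', Q s' → R s') :
    Halts α p s B' R := by
  obtain ⟨t, s', ht, he, hs⟩ := h
  exact ⟨t, s', ht.trans hB, he, hQ _ hs⟩

theorem Halts.seq (h : Halts α p s B Q) (h' : ∀ s', Q s' → Halts α p' s' B' R) :
    Halts α (.seq p p') s (B + B') R := by
  obtain ⟨t, s', ht, he, hs⟩ := h
  obtain ⟨t', s'', ht', he', hs'⟩ := h' s' hs
  exact ⟨t + t', s'', Nat.add_le_add ht ht', .seq he he', hs'⟩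

theorem Halts.of_exec {t : ℕ} {s' : RamState K} (h : RamExec α p s t s') (hQ : Q s') :
    Halts α p s t Q :=
  ⟨t, s', le_rfl, h, hQ⟩

theorem Halts.of_exec_seq {t : ℕ} {s' : RamState K} (h : RamExec α p s t s')
    (h' : Halts α p' s' B' Q) : Halts α (.seq p p') s (B' + t) Q := by
  rw [add_comm]
  exact (Halts.of_exec h (Q := (· = s')) rfl).seq fun _ hs => hs ▸ h'

theorem halts_whileNonzero {r : ℕ} (Inv : ℕ → RamState K → Prop) (J : ℕ)
    (hstep : ∀ j < J, ∀ s, Inv j s → s.N r ≠ 0 ∧ Halts α p s B (Inv (j + 1)))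
    (hend : ∀ s, Inv J s → s.N r = 0) (h0 : Inv 0 s) :
    Halts α (.whileNonzero r p) s (J * (B + 1) + 1) (Inv J) := by
  induction J generalizing Inv s with
  | zero => exact (Halts.of_exec (.whileNonzero_zero (hend s h0)) h0).mono (by simp) fun _ => id
  | succ J ih =>
    obtain ⟨hr, t, s', ht, he, hs⟩ := hstep 0 (by simp) s h0
    obtain ⟨t', s'', ht', he', hs'⟩ := ih (fun j => Inv (j + 1))
      (fun j hj => hstep (j + 1) (by simpa using hj)) hend hs
    refine ⟨t + t' + 1, s'', ?_, .whileNonzero_pos hr he he', hs'⟩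
    rw [Nat.succ_mul]
    omega

/-- Repeat `body` with the loop variable `N[r]` running down from `N[r] - 1` to `0`. Here and
below `N[3]` is expected to contain `1` and `N[4]` to contain `0`. -/
def RamProg.countdown (r : ℕ) (body : RamProg) : RamProg :=
  .whileNonzero r (.seq (.sub r r 3) body)

theorem halts_countdown {m q r : ℕ} (Inv : ℕ → RamState K → Prop) (hm : 3 < m) (hr : m ≤ r)
    (h3 : s.N 3 = 1) (h0 : Inv 0 s)
    (hInv : ∀ j s' x, Inv j s' → Inv j { s' with N := Function.update s'.N r x })
    (hbody : ∀ j < s.N r, ∀ s', s.Keeps m q s' → s'.N r = s.N r - (j + 1) → Inv j s' →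
      Halts α p s' B fun s'' => s'.Keeps m q s'' ∧ s''.N r = s'.N r ∧ Inv (j + 1) s'') :
    Halts α (.countdown r p) s (s.N r * (B + 2) + 1) fun s' => s.Keeps m q s' ∧ Inv (s.N r) s' := by
  refine (halts_whileNonzero (B := B + 1)
    (fun j s' => s.Keeps m q s' ∧ s'.N r = s.N r - j ∧ Inv j s') (s.N r) ?_ ?_
    ⟨.refl s, by simp, h0⟩).mono le_rfl fun s' h => ⟨h.1, h.2.2⟩
  · rintro j hj s' ⟨hk, hN, hs'⟩
    refine ⟨by omega, Halts.of_exec_seq (.sub r r 3 s') ?_⟩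
    have hN' : s'.N r - s'.N 3 = s.N r - (j + 1) := by
      rw [hN, hk.nat 3 hm, h3, Nat.sub_sub]
    refine (hbody j hj _ (hk.update_nat hr _) (by simpa using hN') (hInv j s' _ hs')).mono
      le_rfl ?_
    rintro s'' ⟨hk', hN'', hs''⟩
    exact ⟨(hk.update_nat hr _).trans hk', hN''.trans (by simpa using hN'), hs''⟩
  · rintro s' ⟨-, hN, -⟩
    simpa using hN

end Halting

section Output

variable {K : Type v} {n : ℕ} {s s' s'' : RamState K} {S S' : Set (Fin n → K)}

/-- Between the two states the points of the set `S` are output, in some order and possibly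
repeatedly. -/
def RamState.Emits (S : Set (Fin n → K)) (s s' : RamState K) : Prop :=
  ∃ H : List (Fin n → K), s'.out = s.out ++ (H.map List.ofFn).flatten ∧ {x | x ∈ H} = S

theorem RamState.Emits.trans (h : s.Emits S s') (h' : s'.Emits S' s'') :
    s.Emits (S ∪ S') s'' := by
  obtain ⟨H, hH, rfl⟩ := h
  obtain ⟨H', hH', rfl⟩ := h'
  exact ⟨H ++ H', by simp [hH, hH'], by ext; simp⟩

theorem halts_countdown_emits [Field K] {α : ℕ → K} {m q B G : ℕ} {p : RamProg}
    (S : ℕ → Set (Fin n → K)) (hm : 3 < m) (h3 : s.N 3 = 1) (hG : s.N m = G)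
    (hbody : ∀ i < G, ∀ s', s.Keeps m q s' → s'.N m = i →
      Halts α p s' B fun s'' => s'.Keeps (m + 1) q s'' ∧ s'.Emits (S i) s'') :
    Halts α (.countdown m p) s (G * (B + 2) + 1) fun s' =>
      s.Keeps m q s' ∧ s.Emits {x | ∃ i < G, x ∈ S i} s' := by
  subst hG
  refine (halts_countdown (m := m) (q := q)
    (fun j s' => s.Emits {x | ∃ i < s.N m, s.N m ≤ i + j ∧ x ∈ S i} s')
    hm le_rfl h3 ⟨[], by simp, ?_⟩ (fun _ _ _ h => h) ?_).mono le_rfl ?_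
  · ext x
    simp only [List.not_mem_nil, Set.mem_ofPred_eq, false_iff]
    rintro ⟨i, hi, hi', -⟩
    omega
  · intro j hj s' hk hN he
    refine (hbody _ (by omega) s' hk hN).mono le_rfl ?_
    rintro s'' ⟨hk', he'⟩
    refine ⟨hk'.mono (by omega) le_rfl, hk'.nat m (by omega), ?_⟩
    convert he.trans he' using 1
    ext x
    constructor
    · rintro ⟨i, hi, hij, hx⟩
      by_cases h : i = s.N m - (j + 1)
      · exact Or.inr (h ▸ hx)
      · exact Or.inl ⟨i, hi, by omega, hx⟩
    · rintro (⟨i, hi, hij, hx⟩ | hx)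
      · exact ⟨i, hi, by omega, hx⟩
      · exact ⟨_, by omega, by omega, hx⟩
  · rintro s' ⟨hk, he⟩
    exact ⟨hk, by simpa only [Nat.le_add_left, true_and] using he⟩

end Output

namespace RamProg

/-- Multiply `A[3]` by `A[0] ^ N[12]` and `A[4]` by `A[2] ^ N[12]`. -/
def mulPowers : RamProg :=
  .countdown 12 (.seq (.fmul 3 3 0) (.fmul 4 4 2))

/-- Output the coordinate `A[0] ^ N[11] + A[1] * A[2] ^ N[11]` of a point of the curve. -/
def emitCoordinate : RamProg :=
  .seq (.add 12 11 4) (.seq (.fone 3) (.seq (.fone 4) (.seq mulPowers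
    (.seq (.fmul 5 1 4) (.seq (.fadd 5 3 5) (.emit 5))))))

/-- Replace `N[11]`, which is at most `N[6]`, by twice its value modulo `N[6] + 1`. -/
def doubleMod : RamProg :=
  .seq (.add 11 11 11) (.seq (.sub 13 11 6) (.ifZero 13 (.const 13 0) (.sub 11 13 3)))

/-- Output `N[10]` coordinates, doubling the weight `N[11]` modulo `N[6] + 1` after each of them. -/
def emitCoordinates : RamProg :=
  .countdown 10 (.seq emitCoordinate doubleMod)

/-- Output the point of the curve with the parameters `A[0]`, `A[1]`, `A[2]` and with the weights
`2 ^ r` modulo `N[6] + 1` for `r < N[0]`. The initial weight `1 - (1 - N[6])` is `1` modulo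
`N[6] + 1`. -/
def emitPoint : RamProg :=
  .seq (.sub 11 3 6) (.seq (.sub 11 3 11) (.seq (.add 10 0 4) emitCoordinates))

/-- Run `body` with `A[a] = α i` for all `i < N[5]`, where `N[r]` is the loop variable. -/
def forElem (a r : ℕ) (body : RamProg) : RamProg :=
  .seq (.add r 5 4) (.countdown r (.seq (.felem a r) body))

/-- Output `curveGrid α n M G`, where `n = N[0]`, `G = N[5]` and `M = N[6]`. -/
def emitGrid : RamProg :=
  .countdown 6 (.forElem 0 7 (.forElem 1 8 (.forElem 2 9 emitPoint)))

/-- Put `(N[0] + 1) * N[8]` into `N[11]`. -/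
def mulSucc : RamProg :=
  .seq (.add 11 8 4) (.seq (.add 12 0 4) (.countdown 12 (.add 11 11 8)))

/-- Multiply `N[8]` by `(N[0] + 1) ^ N[10]`. -/
def mulPow : RamProg :=
  .countdown 10 (.seq mulSucc (.add 8 11 4))

/-- Put `(N[0] + 1) ^ (N[5] * ⌈log₂ N[6]⌉)` into `N[8]`. The logarithm is not computed: one factor
`(N[0] + 1) ^ N[5]` is taken for each doubling of `N[7]` until it reaches `N[6]`. -/
def powClog : RamProg :=
  .seq (.const 7 1) (.seq (.const 8 1) (.seq (.sub 9 6 7) (.whileNonzero 9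
    (.seq (.add 10 5 4) (.seq mulPow (.seq (.add 7 7 7) (.sub 9 6 7)))))))

/-- Compute the parameters of the grid from the input `n = N[0]`, `k = N[1]`, `δ = N[2]`. -/
def gridBounds : RamProg :=
  .seq (.const 3 1) (.seq (.add 5 2 2) (.seq (.add 5 5 5) (.seq (.add 5 5 5) (.seq (.add 6 1 3)
    (.seq powClog (.seq mulSucc (.seq (.add 5 11 4) (.add 6 8 4))))))))

/-- Output a hitting-set for the input `n = N[0]`, `k = N[1]`, `δ = N[2]`. -/
def hittingSet : RamProg := .seq gridBounds emitGrid

end RamProg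

/-- The number `M` of moduli that the program tries for the weights `2 ^ r`. -/
def modulusBound (n k δ : ℕ) : ℕ := (n + 1) ^ (8 * δ * Nat.clog 2 (k + 1))

/-- The number `G` of field elements that the program tries for each parameter of the curve. -/
def elemBound (n k δ : ℕ) : ℕ := (n + 1) * modulusBound n k δ

/-- The registers `N[0]`, `N[3]`, `N[4]`, `N[5]`, `N[6]` contain `n`, `1`, `0`, `G`, `m`. -/
structure RamState.HasParams {K : Type v} (s : RamState K) (n G m : ℕ) : Prop where
  dim : s.N 0 = n
  one : s.N 3 = 1
  zero : s.N 4 = 0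
  bound : s.N 5 = G
  modulus : s.N 6 = m

theorem RamState.HasParams.of_keeps {K : Type v} {s s' : RamState K} {n G m r q : ℕ}
    (h : s.HasParams n G m) (hk : s.Keeps r q s') (hr : 7 ≤ r) : s'.HasParams n G m :=
  ⟨(hk.nat 0 (by omega)).trans h.dim, (hk.nat 3 (by omega)).trans h.one,
    (hk.nat 4 (by omega)).trans h.zero, (hk.nat 5 (by omega)).trans h.bound,
    (hk.nat 6 (by omega)).trans h.modulus⟩

section Points

variable {K : Type v} [Field K] {α : ℕ → K} {s : RamState K} {n G m : ℕ}

theorem halts_mulPowers (h3 : s.N 3 = 1) :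
    Halts α .mulPowers s (s.N 12 * 4 + 1) fun s' => s.Keeps 12 3 s' ∧ s'.out = s.out ∧
      s'.A 3 = s.A 3 * s.A 0 ^ s.N 12 ∧ s'.A 4 = s.A 4 * s.A 2 ^ s.N 12 := by
  refine halts_countdown (fun j s' => s'.out = s.out ∧ s'.A 3 = s.A 3 * s.A 0 ^ j ∧
    s'.A 4 = s.A 4 * s.A 2 ^ j) (by norm_num) le_rfl h3 (by simp) (fun _ _ _ h => h) ?_
  rintro j - s' hk - ⟨ho, h3, h4⟩
  have h0 := hk.field 0 (by norm_num)
  have h2 := hk.field 2 (by norm_num)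
  exact .of_exec_seq (.fmul ..) (.of_exec (.fmul ..) ⟨((RamState.Keeps.refl s').update_field
    le_rfl _).update_field (by norm_num) _, rfl, ho, by simp [h0, h3, pow_succ, mul_assoc],
    by simp [h2, h4, pow_succ, mul_assoc]⟩)

theorem halts_emitCoordinate (h3 : s.N 3 = 1) (h4 : s.N 4 = 0) :
    Halts α .emitCoordinate s (s.N 11 * 4 + 7) fun s' => s.Keeps 12 3 s' ∧
      s'.out = s.out ++ [s.A 0 ^ s.N 11 + s.A 1 * s.A 2 ^ s.N 11] := by
  refine (Halts.of_exec_seq (.add ..) (.of_exec_seq (.fone ..) (.of_exec_seq (.fone ..)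
    ((halts_mulPowers (by simpa)).seq (B' := 3) ?_)))).mono (by simp [h4]) fun _ => id
  rintro s' ⟨hk, ho, ha, hc⟩
  simp only [Function.update_self, Function.update_of_ne, ne_eq, Nat.reduceEqDiff,
    not_false_eq_true, OfNat.zero_ne_ofNat, h4, add_zero, one_mul] at ho ha hc
  have hk' : s.Keeps 12 3 s' := ((((RamState.Keeps.refl s).update_nat le_rfl _).update_field
    le_rfl _).update_field (by norm_num) _).trans hk
  have h1 := hk'.field 1 (by norm_num)
  refine .of_exec_seq (.fmul ..) (.of_exec_seq (.fadd ..) (.of_exec (.emit ..) ⟨?_, ?_⟩))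
  · exact ⟨hk'.nat, ((hk'.update_field (by norm_num) _).update_field (by norm_num) _).field⟩
  · simp [ho, ha, hc, h1]

theorem halts_doubleMod {q : ℕ} (h3 : s.N 3 = 1) (hs : s.N 11 ≤ s.N 6) :
    Halts α .doubleMod s 4 fun s' => s.Keeps 11 q s' ∧ s'.out = s.out ∧
      s'.N 11 = 2 * s.N 11 % (s.N 6 + 1) := by
  refine Halts.of_exec_seq (.add ..) (.of_exec_seq (.sub ..) ?_)
  have hk := ((RamState.Keeps.refl (m := 11) (q := q) s).update_nat le_rfl
    (s.N 11 + s.N 11)).update_nat (show 11 ≤ 13 by norm_num) (s.N 11 + s.N 11 - s.N 6)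
  by_cases hz : s.N 11 + s.N 11 - s.N 6 = 0
  · refine .of_exec (.ifZero_zero (by simpa) (.const ..)) ⟨hk.update_nat (by norm_num) _, rfl, ?_⟩
    have h : 2 * s.N 11 % (s.N 6 + 1) = 2 * s.N 11 := Nat.mod_eq_of_lt (by omega)
    rw [two_mul] at h
    simp [two_mul, h]
  · refine .of_exec (.ifZero_pos (by simpa) (.sub ..)) ⟨hk.update_nat le_rfl _, rfl, ?_⟩
    have h : 2 * s.N 11 % (s.N 6 + 1) = s.N 11 + s.N 11 - s.N 6 - 1 := by
      rw [Nat.mod_eq_sub_mod (by omega), Nat.mod_eq_of_lt (by omega)]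
      omega
    simp [h, h3]

theorem halts_emitCoordinates (h : s.HasParams n G m) (h11 : s.N 11 = 1 % (m + 1)) :
    Halts α .emitCoordinates s (s.N 10 * (4 * m + 13) + 1) fun s' => s.Keeps 10 3 s' ∧
      s'.out = s.out ++ (List.range (s.N 10)).map fun r =>
        s.A 0 ^ (2 ^ r % (m + 1)) + s.A 1 * s.A 2 ^ (2 ^ r % (m + 1)) := by
  refine (halts_countdown (B := 4 * m + 11) (m := 10) (q := 3) (fun j s' =>
    s'.N 11 = 2 ^ j % (m + 1) ∧ s'.out = s.out ++ (List.range j).map fun r =>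
      s.A 0 ^ (2 ^ r % (m + 1)) + s.A 1 * s.A 2 ^ (2 ^ r % (m + 1)))
    (by norm_num) le_rfl h.one (by simp [h11]) (by simp) ?_).mono le_rfl
    fun s' h => ⟨h.1, h.2.2⟩
  rintro j - s' hk - ⟨hw, ho⟩
  have hs' := h.of_keeps hk (by norm_num)
  have hwm : s'.N 11 ≤ m := hw ▸ Nat.le_of_lt_succ (Nat.mod_lt _ m.succ_pos)
  refine ((halts_emitCoordinate hs'.one hs'.zero).seq (B' := 4) ?_).mono (by omega) fun _ => id
  rintro s₁ ⟨hk₁, ho₁⟩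
  have hs₁ := hs'.of_keeps hk₁ (by norm_num)
  have h11 : s₁.N 11 = s'.N 11 := hk₁.nat 11 (by norm_num)
  refine (halts_doubleMod (q := 3) hs₁.one (by rwa [h11, hs₁.modulus])).mono le_rfl ?_
  rintro s₂ ⟨hk₂, ho₂, hw₂⟩
  refine ⟨(hk₁.mono (by norm_num) le_rfl).trans (hk₂.mono (by norm_num) le_rfl),
    (hk₂.nat 10 (by norm_num)).trans (hk₁.nat 10 (by norm_num)), ?_, ?_⟩
  · rw [hw₂, h11, hw, hs₁.modulus, pow_succ', Nat.mul_mod_mod]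
  · rw [ho₂, ho₁, ho, hw, hk.field 0 (by norm_num), hk.field 1 (by norm_num),
      hk.field 2 (by norm_num), List.range_succ, List.map_append, List.append_assoc,
      List.map_singleton]

theorem halts_emitPoint (h : s.HasParams n G m) :
    Halts α .emitPoint s (n * (4 * m + 13) + 4) fun s' => s.Keeps 10 3 s' ∧
      s.Emits {curvePoint (fun r : Fin n => 2 ^ r.val % (m + 1)) (s.A 0) (s.A 1) (s.A 2)} s' := by
  have hk (x y z : ℕ) := (((RamState.Keeps.refl (m := 10) (q := 3) s).update_nat
    (show 10 ≤ 11 by norm_num) x).update_nat (show 10 ≤ 11 by norm_num) y).update_nat le_rfl z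
  have h11 : 1 - (1 - m) = 1 % (m + 1) := by cases m <;> simp
  refine (Halts.of_exec_seq (.sub ..) (.of_exec_seq (.sub ..) (.of_exec_seq (.add ..)
    (halts_emitCoordinates (h.of_keeps (hk _ _ _) (by norm_num)) ?_)))).mono ?_ ?_
  · simp [h.one, h.modulus, h11]
  · simp [h.dim, h.zero]
  · rintro s' ⟨hk', ho⟩
    refine ⟨(hk _ _ _).trans hk', [_], ?_, Set.ext fun x => List.mem_singleton⟩
    rw [ho]
    simp [curvePoint, List.ofFn_eq_map, ← List.map_coe_finRange_eq_range, h.dim, h.zero]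

theorem halts_forElem {a r c e : ℕ} {p : RamProg} {S : ℕ → Set (Fin n → K)}
    (h : s.HasParams n G m) (hr : 7 ≤ r) (hG : 1 ≤ G)
    (hp : ∀ i < G, ∀ s' : RamState K, s.Keeps r a s' → s'.A a = α i →
      Halts α p s' (c * G ^ e) fun s'' => s'.Keeps (r + 1) (a + 1) s'' ∧ s'.Emits (S i) s'') :
    Halts α (.forElem a r p) s ((c + 5) * G ^ (e + 1)) fun s' =>
      s.Keeps r a s' ∧ s.Emits {x | ∃ i < G, x ∈ S i} s' := by
  have hk := (RamState.Keeps.refl (m := r) (q := a) s).update_nat le_rfl (s.N 5 + s.N 4)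
  refine (Halts.of_exec_seq (.add ..) (halts_countdown_emits (q := a) (G := G) S (by omega)
    (h.of_keeps hk hr).one (by simp [h.bound, h.zero]) (B := c * G ^ e + 1) ?_)).mono ?_ ?_
  · intro i hi s₁ hk₁ hi₁
    refine .of_exec_seq (.felem ..) ((hp i hi _ ((hk.trans hk₁).update_field le_rfl _)
      (by simp [hi₁])).mono le_rfl ?_)
    rintro s₂ ⟨hk₂, he⟩
    exact ⟨((RamState.Keeps.refl s₁).update_field le_rfl _).trans (hk₂.mono le_rfl (by simp)), he⟩
  · have : 1 ≤ G ^ (e + 1) := Nat.one_le_pow _ _ hG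
    have : G ≤ G ^ (e + 1) := Nat.le_self_pow (by simp) G
    calc G * (c * G ^ e + 1 + 2) + 1 + 1 = c * G ^ (e + 1) + 3 * G + 2 := by ring
      _ ≤ (c + 5) * G ^ (e + 1) := by rw [add_mul]; omega
  · rintro s₁ ⟨hk₁, he⟩
    exact ⟨hk.trans hk₁, he⟩

theorem halts_emitGrid {M : ℕ} (h : s.HasParams n G M) (hMG : M ≤ G) (hG : n * M + n < G) :
    Halts α .emitGrid s (31 * G ^ 5) fun s' => s.Emits (curveGrid α n M G) s' := by
  let w (m : ℕ) (r : Fin n) : ℕ := 2 ^ r.val % (m + 1)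
  refine (halts_countdown_emits (q := 0) (B := 28 * G ^ 4)
    (fun m => {x | ∃ i < G, ∃ j < G, ∃ l < G, x = curvePoint (w m) (α i) (α j) (α l)})
    (by norm_num) h.one h.modulus ?_).mono ?_ fun s' h' => h'.2
  · intro m hm s₁ hk hsm
    have hs₁ : s₁.HasParams n G m := ⟨(hk.nat 0 (by norm_num)).trans h.dim,
      (hk.nat 3 (by norm_num)).trans h.one, (hk.nat 4 (by norm_num)).trans h.zero,
      (hk.nat 5 (by norm_num)).trans h.bound, hsm⟩
    refine halts_forElem (S := fun i => {x | ∃ j < G, ∃ l < G, x = curvePoint (w m) (α i) (α j)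
      (α l)}) hs₁ le_rfl (by omega) fun i _ s₂ hk₂ ha => ?_
    have hs₂ := hs₁.of_keeps hk₂ le_rfl
    refine halts_forElem (S := fun j => {x | ∃ l < G, x = curvePoint (w m) (α i) (α j) (α l)})
      hs₂ (by norm_num) (by omega) fun j _ s₃ hk₃ hb => ?_
    have hs₃ := hs₂.of_keeps hk₃ (by norm_num)
    refine halts_forElem (S := fun l => {curvePoint (w m) (α i) (α j) (α l)}) (e := 1) (c := 13)
      hs₃ (by norm_num) (by omega) fun l _ s₄ hk₄ hc => ?_
    refine (halts_emitPoint (hs₃.of_keeps hk₄ (by norm_num))).mono ?_ ?_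
    · have : n * m ≤ n * M := Nat.mul_le_mul_left n hm.le
      calc n * (4 * m + 13) + 4 = 4 * (n * m) + 13 * n + 4 := by ring
        _ ≤ 13 * G ^ 1 := by rw [pow_one]; omega
    · have ha' : s₄.A 0 = α i := by
        rw [hk₄.field 0 (by norm_num), hk₃.field 0 (by norm_num), ha]
      have hb' : s₄.A 1 = α j := by rw [hk₄.field 1 (by norm_num), hb]
      rw [ha', hb', hc]
      exact fun _ => id
  · calc M * (28 * G ^ 4 + 2) + 1 ≤ G * (28 * G ^ 4 + 2) + 1 := by gcongr
      _ ≤ 31 * G ^ 5 := by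
        have : G ≤ G ^ 5 := Nat.le_self_pow (by simp) G
        have : 1 ≤ G := by omega
        linarith

end Points

section Bounds

variable {K : Type v} [Field K] {α : ℕ → K} {s : RamState K}

theorem halts_mulSucc (h3 : s.N 3 = 1) (h4 : s.N 4 = 0) :
    Halts α .mulSucc s (s.N 0 * 3 + 3) fun s' => s.Keeps 11 0 s' ∧ s'.out = s.out ∧
      s'.N 11 = (s.N 0 + 1) * s.N 8 := by
  have hk (x y : ℕ) := ((RamState.Keeps.refl (m := 11) (q := 0) s).update_nat le_rfl x).update_nat
    (show 11 ≤ 12 by norm_num) y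
  refine (Halts.of_exec_seq (.add ..) (.of_exec_seq (.add ..) (halts_countdown (B := 1) (m := 11)
    (q := 0) (fun j s' => s'.out = s.out ∧ s'.N 11 = (j + 1) * s.N 8) (by norm_num) (by norm_num)
    (by simpa using h3) (by simp [h4]) (by simp) ?_))).mono (by simp [h4]) ?_
  · rintro j - s' hk' - ⟨ho, h11⟩
    have h8 := ((hk _ _).trans hk').nat 8 (by norm_num)
    refine .of_exec (.add ..) ⟨(RamState.Keeps.refl s').update_nat le_rfl _, by simp, ho, ?_⟩
    simp [h8, h11, add_mul]
  · rintro s' ⟨hk', ho, h11⟩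
    exact ⟨(hk _ _).trans hk', ho, by simpa [h4] using h11⟩

theorem halts_mulPow (h3 : s.N 3 = 1) (h4 : s.N 4 = 0) :
    Halts α .mulPow s (s.N 10 * (s.N 0 * 3 + 6) + 1) fun s' => s.Keeps 8 0 s' ∧ s'.out = s.out ∧
      s'.N 8 = s.N 8 * (s.N 0 + 1) ^ s.N 10 := by
  refine halts_countdown (B := s.N 0 * 3 + 4) (m := 8)
    (fun j s' => s'.out = s.out ∧ s'.N 8 = s.N 8 * (s.N 0 + 1) ^ j) (by norm_num) (by norm_num)
    h3 (by simp) (by simp) ?_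
  rintro j - s₁ hk₁ - ⟨ho₁, h8⟩
  have h0 := hk₁.nat 0 (by norm_num)
  have h4' : s₁.N 4 = 0 := (hk₁.nat 4 (by norm_num)).trans h4
  refine ((halts_mulSucc ((hk₁.nat 3 (by norm_num)).trans h3) h4').seq (B' := 1) ?_).mono
    (by rw [h0]) fun _ => id
  rintro s₂ ⟨hk₂, ho₂, h11⟩
  have h4'' : s₂.N 4 = 0 := (hk₂.nat 4 (by norm_num)).trans h4'
  refine .of_exec (.add ..) ⟨(hk₂.mono (by norm_num) le_rfl).update_nat le_rfl _,
    by simp [hk₂.nat 10], ho₂.trans ho₁, ?_⟩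
  calc _ = (s.N 0 + 1) * (s.N 8 * (s.N 0 + 1) ^ j) := by simp [h4'', h11, h0, h8]
    _ = s.N 8 * (s.N 0 + 1) ^ (j + 1) := by ring

theorem halts_powClog (h3 : s.N 3 = 1) (h4 : s.N 4 = 0) :
    Halts α .powClog s (Nat.clog 2 (s.N 6) * (s.N 5 * (s.N 0 * 3 + 6) + 5) + 4) fun s' =>
      s.Keeps 7 0 s' ∧ s'.out = s.out ∧ s'.N 8 = (s.N 0 + 1) ^ (s.N 5 * Nat.clog 2 (s.N 6)) := by
  refine (Halts.of_exec_seq (.const ..) (.of_exec_seq (.const ..) (.of_exec_seq (.sub ..)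
    (halts_whileNonzero (B := s.N 5 * (s.N 0 * 3 + 6) + 4) (fun j s' => s.Keeps 7 0 s' ∧
      s'.out = s.out ∧ s'.N 7 = 2 ^ j ∧ s'.N 8 = (s.N 0 + 1) ^ (s.N 5 * j) ∧
      s'.N 9 = s.N 6 - 2 ^ j) (Nat.clog 2 (s.N 6)) ?_ ?_ ?_)))).mono le_rfl
    fun s' h => ⟨h.1, h.2.1, h.2.2.2.1⟩
  · rintro j hj s₁ ⟨hk₁, ho₁, h7, h8, h9⟩
    have hlt : 2 ^ j < s.N 6 := (Nat.lt_clog_iff_pow_lt (by norm_num)).1 hj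
    have h0 := hk₁.nat 0 (by norm_num)
    have h3' := (hk₁.nat 3 (by norm_num)).trans h3
    have h4' := (hk₁.nat 4 (by norm_num)).trans h4
    have h5 := hk₁.nat 5 (by norm_num)
    refine ⟨by omega, (Halts.of_exec_seq (.add ..) ((halts_mulPow (by simpa) (by simpa)).seq
      (B' := 2) ?_)).mono ?_ fun _ => id⟩
    · rintro s₂ ⟨hk₂, ho₂, h8'⟩
      have hk := (hk₁.update_nat (show 7 ≤ 10 by norm_num) _).trans
        (hk₂.mono (by norm_num) le_rfl)
      have h7' : s₂.N 7 = 2 ^ j := (hk₂.nat 7 (by norm_num)).trans (by simpa)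
      have h6 := hk.nat 6 (by norm_num)
      refine .of_exec_seq (.add ..) (.of_exec (.sub ..) ⟨(hk.update_nat le_rfl _).update_nat
        (by norm_num) _, ho₂.trans ho₁, ?_, ?_, ?_⟩)
      · simp [h7', pow_succ, mul_two]
      · simp [h8', h8, h0, h5, h4', ← pow_add, mul_add]
      · simp [h7', h6, pow_succ, mul_two]
    · simp [h0, h5, h4']
  · rintro s' ⟨-, -, -, -, h9⟩
    rw [h9, Nat.sub_eq_zero_iff_le]
    exact Nat.le_pow_clog (by norm_num) _
  · exact ⟨(((RamState.Keeps.refl s).update_nat le_rfl _).update_nat (by norm_num) _).update_nat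
      (by norm_num) _, by simp⟩

theorem halts_gridBounds (n k δ : ℕ) :
    Halts α .gridBounds (RamState.initial K n k δ)
      (Nat.clog 2 (k + 1) * (8 * δ * (n * 3 + 6) + 5) + 3 * n + 14) fun s' =>
        s'.out = [] ∧ s'.HasParams n (elemBound n k δ) (modulusBound n k δ) := by
  have h8δ : 8 * δ = δ + δ + (δ + δ) + (δ + δ + (δ + δ)) := by ring
  refine (Halts.of_exec_seq (.const ..) (.of_exec_seq (.add ..) (.of_exec_seq (.add ..)
    (.of_exec_seq (.add ..) (.of_exec_seq (.add ..) ((halts_powClog (by simp)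
      (by simp [RamState.initial])).seq (B' := n * 3 + 5) ?_)))))).mono ?_ fun _ => id
  · rintro s₁ ⟨hk₁, ho₁, h8⟩
    have h0 : s₁.N 0 = n := (hk₁.nat 0 (by norm_num)).trans (by simp [RamState.initial])
    have h3 : s₁.N 3 = 1 := (hk₁.nat 3 (by norm_num)).trans (by simp)
    have h4 : s₁.N 4 = 0 := (hk₁.nat 4 (by norm_num)).trans (by simp [RamState.initial])
    have h8' : s₁.N 8 = modulusBound n k δ := by
      simp [h8, modulusBound, RamState.initial, h8δ]
    refine ((halts_mulSucc h3 h4).seq (B' := 2) ?_).mono (by rw [h0]) fun _ => id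
    rintro s₂ ⟨hk₂, ho₂, h11⟩
    have hk := fun i hi => hk₂.nat i hi
    refine .of_exec_seq (.add ..) (.of_exec (.add ..) ⟨ho₂.trans (ho₁.trans rfl), ?_⟩)
    constructor <;> simp [hk, h0, h3, h4, h8', h11, elemBound]
  · simp only [Function.update_self, Function.update_of_ne, ne_eq, Nat.reduceEqDiff,
      not_false_eq_true, OfNat.zero_ne_ofNat, OfNat.one_ne_ofNat, RamState.initial, if_true,
      if_false, one_ne_zero, h8δ]
    omega

theorem clog_mul_le_elemBound {n k δ : ℕ} (hn : 1 ≤ n) (hδ : 1 ≤ δ) :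
    Nat.clog 2 (k + 1) * (8 * δ * (n * 3 + 6) + 5) + 3 * n + 14 ≤ 25 * elemBound n k δ := by
  set L := Nat.clog 2 (k + 1)
  have hxM : 8 * δ * L ≤ modulusBound n k δ :=
    (Nat.lt_two_pow_self.trans_le (Nat.pow_le_pow_left (by omega) _)).le
  have hLM : L ≤ modulusBound n k δ := (Nat.le_mul_of_pos_left L (by omega)).trans hxM
  have hM : 1 ≤ modulusBound n k δ := Nat.one_le_pow _ _ n.succ_pos
  rw [elemBound]
  nlinarith [Nat.mul_le_mul_left n hxM, Nat.mul_le_mul_left n hLM, Nat.mul_le_mul_left n hM]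

theorem mul_modulusBound_add_lt_elemBound {n k δ : ℕ} (hk : 1 ≤ k) (hδ : 1 ≤ δ) :
    n * modulusBound n k δ + n < elemBound n k δ := by
  have hx : 0 < 8 * δ * Nat.clog 2 (k + 1) :=
    Nat.mul_pos (by omega) (Nat.clog_pos (by norm_num) (by omega))
  have hM : n + 1 ≤ modulusBound n k δ := Nat.le_self_pow hx.ne' _
  rw [elemBound, Nat.succ_mul]
  omega

theorem two_pow_mul_elemBound_pow_le {n k δ : ℕ} (hn : 1 ≤ n) (hk : 1 ≤ k) (hδ : 1 ≤ δ) :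
    2 ^ 6 * elemBound n k δ ^ 5 ≤ (n + 1) ^ (91 * δ * Nat.log 2 (k + 1)) := by
  set L := Nat.log 2 (k + 1)
  have hL1 : 1 ≤ L := Nat.log_pos (by norm_num) (by omega)
  have hclog : Nat.clog 2 (k + 1) ≤ 2 * L :=
    (Nat.clog_le_of_le_pow (Nat.lt_pow_succ_log_self (by norm_num) _).le).trans (by omega)
  have hδL : 1 ≤ δ * L := Nat.mul_pos hδ hL1
  calc 2 ^ 6 * elemBound n k δ ^ 5
      ≤ (n + 1) ^ 6 * elemBound n k δ ^ 5 := by gcongr; omega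
    _ = (n + 1) ^ (11 + 40 * δ * Nat.clog 2 (k + 1)) := by
      rw [elemBound, modulusBound]
      ring
    _ ≤ (n + 1) ^ (91 * δ * L) := by
      refine Nat.pow_le_pow_right n.succ_pos ?_
      nlinarith [Nat.mul_le_mul_left δ hclog]

theorem halts_hittingSet (α : ℕ → K) {n k δ : ℕ} (hn : 1 ≤ n) (hk : 1 ≤ k) (hδ : 1 ≤ δ) :
    Halts α .hittingSet (RamState.initial K n k δ) (2 ^ 6 * elemBound n k δ ^ 5) fun s =>
      ∃ H : List (Fin n → K), s.out = (H.map List.ofFn).flatten ∧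
        {x | x ∈ H} = curveGrid α n (modulusBound n k δ) (elemBound n k δ) := by
  refine ((halts_gridBounds n k δ).seq (B' := 31 * elemBound n k δ ^ 5) ?_).mono ?_ fun _ => id
  · rintro s ⟨ho, h⟩
    refine (halts_emitGrid h (Nat.le_mul_of_pos_left _ n.succ_pos)
      (mul_modulusBound_add_lt_elemBound hk hδ)).mono le_rfl ?_
    rintro s' ⟨H, hs', hH⟩
    exact ⟨H, by simpa [ho] using hs', hH⟩
  · have h5 : elemBound n k δ ≤ elemBound n k δ ^ 5 := Nat.le_self_pow (by norm_num) _
    have := clog_mul_le_elemBound (k := k) hn hδ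
    omega

end Bounds

/-- One program, independent of the field, outputs for all `n, k, δ ≥ 1` a hitting-set for the
`n`-variate multilinear depth-3 circuits with top fan-in `k` and `δ`-distance within
`T = (n + 1) ^ (c * δ * ⌊log₂ (k + 1)⌋)` steps, which is `n ^ O(δ log k)` for `n, k ≥ 2`.
The points have coordinates in any field `K` that extends the field `F` of the circuits and has at
least `T` elements (`K = F` if `F` is large enough); distinct elements `α 0, α 1, …` of `K` are
accessible to the program. -/
theorem theorem1 :
    ∃ (p : RamProg) (c : ℕ), ∀ n k δ : ℕ, 1 ≤ n → 1 ≤ k → 1 ≤ δ →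
      ∀ (K : Type v) [Field K] (α : ℕ → K),
        Set.InjOn α {i | i < (n + 1) ^ (c * δ * Nat.log 2 (k + 1))} →
        ∃ H : List (Fin n → K),
          OutputsPointsWithin α p n k δ ((n + 1) ^ (c * δ * Nat.log 2 (k + 1))) H ∧
          ∀ (F : Type u) [Field F] [Algebra F K], IsHittingSet F k δ {x | x ∈ H} := by
  refine ⟨.hittingSet, 91, fun n k δ hn hk hδ K _ α hα => ?_⟩
  have hT := two_pow_mul_elemBound_pow_le hn hk hδ
  have hG : elemBound n k δ ≤ (n + 1) ^ (91 * δ * Nat.log 2 (k + 1)) :=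
    (Nat.le_self_pow (by norm_num) _).trans ((Nat.le_mul_of_pos_left _ (by norm_num)).trans hT)
  obtain ⟨t, s, ht, hs, H, hout, hH⟩ := halts_hittingSet α hn hk hδ
  refine ⟨H, ⟨t, s, ht.trans hT, hs, hout⟩, fun F _ _ => ?_⟩
  rw [hH]
  refine isHittingSet_curveGrid hn hδ (Nat.clog_pos (by norm_num) (by omega))
    (Nat.le_pow_clog (by norm_num) _) le_rfl
    ((Nat.le_add_right _ n).trans_lt (mul_modulusBound_add_lt_elemBound hk hδ))
    (hα.mono fun i hi => hi.trans_le hG)
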